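/- Fix $d\ge 1$, constants $c_1,\dots,c_7\ge 0$ with $0<c_1\le c_3$, an exponent $\alpha\in(0,1)$ and a continuous function $\sigma\colon[0,\infty)\to[0,\infty)$ with $\sigma(0)=0$ and $\limsup_{t\to\infty}\sigma(t)/t<\infty$. For an open set $U\subset\mathbb R^d$, $\mathrm{BD}(U)$ is the space of $u\in L^1(U;\mathbb R^d)$ whose distributional symmetric gradient $Eu=\frac12(Du+Du^T)$ is a bounded Radon measure on $U$; $|Eu|$ is its total variation with respect to the Frobenius norm, $\mathcal L^d$ is Lebesgue measure and $\mathcal H^{d-1}$ the (normalised) Hausdorff measure. Let $\mathfrak F$ be the collection of functionals $F\colon L^1_{\rm loc}(\mathbb R^d;\mathbb R^d)\times\mathcal B(\mathbb R^d)\to[0,+\infty]$ such that (a) for every $u$, $F(u,\cdot)$ is a Borel measure and $F(u,B)=\inf\{F(u,U): U\supset B \text{ open}\}$ for every Borel set $B$; (b) $F(u,U)=F(v,U)$ if $U$ is bounded and open and $u=v$ a.e. on $U$; (c) for every bounded open $U$: $c_1|Eu|(U)-c_2\mathcal L^d(U)\le F(u,U)\le c_3|Eu|(U)+c_4\mathcal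 L^d(U)$ if $u|_U\in \mathrm{BD}(U)$, and $F(u,U)=+\infty$ if $u|_U\notin \mathrm{BD}(U)$; (d) $F(u+w,B)=F(u,B)$ for every Borel set $B$ and every $w(x)=Ax+b$ with $A$ skew-symmetric and $b\in\mathbb R^d$; (e) $F(u+\ell_A,B)\le F(u,B)+c_5|A|\mathcal L^d(B)$ for every Borel set $B$ and every symmetric matrix $A$, where $\ell_A(y)=Ay$; (f) $F(u+u_{x,\zeta,\nu},B)\le F(u,B)+\sigma(|\zeta|)\mathcal H^{d-1}(B\cap\Pi^\nu_x)$ for every Borel set $B$, every $x,\zeta\in\mathbb R^d$ and every unit vector $\nu$, where $u_{x,\zeta,\nu}(y)=\zeta$ if $(y-x)\cdot\nu>0$ and $0$ otherwise, and $\Pi_x^\nu=\{y:(y-x)\cdot\nu=0\}$. Let $\mathfrak F^{\alpha,\infty}$ be the collection of $F\in\mathfrak F$ such that for every bounded open $U$, every $u$ with $u|_U\in \mathrm{BD}(U)$ and all $s,t>0$ $$\Big|\frac{F(su,U)}{s}-\frac{F(tu,U)}{t}\Big|\le \frac{c_6}{s}\mathcal L^d(U)^\alpha F(su,U)^{1-\alpha}+\frac{c_6}{s}\mathcal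 L^d(U)+\frac{c_6}{t}\mathcal L^d(U)^\alpha F(tu,U)^{1-\alpha}+\frac{c_6}{t}\mathcal L^d(U)+c_7\Big(\frac{F(su,U)}{s}+\frac{F(tu,U)}{t}\Big)\Big(\frac1s+\frac1t\Big),\tag{g}$$ and let $\mathfrak F^{\alpha,\infty}_{\rm sc}$ be the collection of $F\in\mathfrak F^{\alpha,\infty}$ such that $F(\cdot,U)$ is $L^1_{\rm loc}$-lower semicontinuous for every open $U\subset\mathbb R^d$. **Proposition.** Let $F_n\in\mathfrak F^{\alpha,\infty}$ for every $n\in\mathbb N$, and let $F\colon L^1_{\rm loc}(\mathbb R^d;\mathbb R^d)\times\mathcal B(\mathbb R^d)\to[0,+\infty]$ be such that for every bounded open set $U$ the sequence $F_n(\cdot,U)$ $\Gamma$-converges to $F(\cdot,U)$ in the topology of $L^1_{\rm loc}(\mathbb R^d;\mathbb R^d)$. Set $$\widehat F(u,B):=\inf_{U\supset B,\ U\text{ open}}\ \sup_{V\subset U,\ V\text{ bounded open}}F(u,V)\qquad (B\subset\mathbb R^d\text{ Borel}).$$ Then $\widehat F(u,U)=F(u,U)$ for every $u$ and every bounded open $U$,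 and $\widehat F\in\mathfrak F^{\alpha,\infty}_{\rm sc}$. Moreover $F\in\mathfrak F^{\alpha,\infty}_{\rm sc}$ if and only if $F=\widehat F$, that is, if and only if $F$ is the canonical extension to Borel sets of its values on bounded open sets. In particular, inequality (g) passes to the $\Gamma$-limit. -/

import Mathlib

open MeasureTheory Filter Topology
open scoped NNReal ENNReal ContDiff

noncomputable section

namespace BDGamma

/-- `ℝ^d` with its Euclidean norm. -/
abbrev E (d : ℕ) : Type := EuclideanSpace ℝ (Fin d)

/-! ### The space `L¹_loc(ℝ^d; ℝ^d)` -/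

/-- The locally integrable functions `ℝ^d → ℝ^d`, as a linear space. -/
def l1locSubmodule (d : ℕ) : Submodule ℝ (E d → E d) where
  carrier := {u | LocallyIntegrable u volume}
  zero_mem' := locallyIntegrable_zero
  add_mem' := fun hu hv => LocallyIntegrable.add hu hv
  smul_mem' := fun c _ hu => LocallyIntegrable.smul hu c

/-- `L¹_loc(ℝ^d; ℝ^d)`, through representatives: the functionals below have to take the same value
on functions that are equal almost everywhere (locality on open sets). A separate type, so that it
does not inherit the topology of pointwise convergence. -/
def L1loc (d : ℕ) : Type := l1locSubmodule d

instance (d : ℕ) : AddCommGroup (L1loc d) := inferInstanceAs (AddCommGroup (l1locSubmodule d))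

instance (d : ℕ) : Module ℝ (L1loc d) := inferInstanceAs (Module ℝ (l1locSubmodule d))

variable {d : ℕ}

/-- The underlying function. -/
def L1loc.fn (u : L1loc d) : E d → E d := u.1

theorem L1loc.locallyIntegrable (u : L1loc d) : LocallyIntegrable u.fn volume := u.2

def L1loc.mk (f : E d → E d) (hf : LocallyIntegrable f volume) : L1loc d := ⟨f, hf⟩

theorem L1loc.integrable_restrict (n : ℕ) (u : L1loc d) :
    Integrable u.fn (volume.restrict (Metric.closedBall (0 : E d) n)) :=
  u.locallyIntegrable.integrableOn_isCompact (isCompact_closedBall (0 : E d) n)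

/-- The class of the restriction of `u` to the closed ball of radius `n` in `L¹`. -/
def L1loc.restrictBall (n : ℕ) (u : L1loc d) :
    E d →₁[volume.restrict (Metric.closedBall (0 : E d) n)] E d :=
  Integrable.toL1 u.fn (u.integrable_restrict n)

/-- The topology of `L¹_loc`: convergence in `L¹` on each closed ball centred at the origin
(equivalently, on each compact set). -/
instance (d : ℕ) : TopologicalSpace (L1loc d) :=
  ⨅ n : ℕ, TopologicalSpace.induced (L1loc.restrictBall n) inferInstance

/-- The affine function `x ↦ A x + b`. -/
def affineFn (A : Matrix (Fin d) (Fin d) ℝ) (b : E d) : L1loc d :=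
  L1loc.mk (fun x => Matrix.toEuclideanLin A x + b)
    (((Matrix.toEuclideanLin A).continuous_of_finiteDimensional.add
      continuous_const).locallyIntegrable)

/-- The function equal to `ζ` where `(y - x) · ν > 0` and to `0` elsewhere. -/
def jumpFn (x ζ ν : E d) : L1loc d :=
  L1loc.mk ({y : E d | 0 < inner ℝ (y - x) ν}.indicator fun _ => ζ)
    (by
      have hm : MeasurableSet {y : E d | 0 < inner ℝ (y - x) ν} :=
        (isOpen_lt continuous_const (by fun_prop)).measurableSet
      exact (locallyIntegrable_const ζ).indicator hm)

/-- The hyperplane orthogonal to `ν` through `x`. -/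
def hyperplane (x ν : E d) : Set (E d) := {y | inner ℝ (y - x) ν = 0}

/-! ### Functions of bounded deformation -/

/-- Frobenius norm of a matrix. -/
def frob (A : Matrix (Fin d) (Fin d) ℝ) : ℝ := √(∑ i, ∑ j, A i j ^ 2)

/-- `Φ ∈ C_c^∞(U; ℝ^{d×d}_sym)` with `|Φ| ≤ 1`. -/
structure IsTestField (U : Set (E d)) (Φ : E d → Matrix (Fin d) (Fin d) ℝ) : Prop where
  smooth : ∀ i j, ContDiff ℝ ∞ (fun x => Φ x i j)
  compact : HasCompactSupport Φ
  support : tsupport Φ ⊆ U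
  symm : ∀ x, (Φ x).IsSymm
  bound : ∀ x, frob (Φ x) ≤ 1

/-- Row-wise divergence: `(div Φ)_i = ∑_j ∂_j Φ_{ij}`. -/
def rowDiv (Φ : E d → Matrix (Fin d) (Fin d) ℝ) (x : E d) (i : Fin d) : ℝ :=
  ∑ j, fderiv ℝ (fun y => Φ y i j) x (EuclideanSpace.single j 1)

/-- The pairing `⟨Eu, Φ⟩ = -∫ u · div Φ dx` of the distributional symmetric gradient
`Eu = (Du + Duᵀ)/2` with a symmetric test field. -/
def symGradPairing (u : L1loc d) (Φ : E d → Matrix (Fin d) (Fin d) ℝ) : ℝ :=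
  -∫ x, ∑ i, u.fn x i * rowDiv Φ x i

/-- The total variation `|Eu|(U) ∈ [0, ∞]` on the open set `U`, with respect to the Frobenius norm:
the norm of the distribution `Eu` on `U` as a functional on test fields with the supremum norm. It
is finite if and only if `Eu` is a bounded Radon measure on `U`. -/
def symGradVar (u : L1loc d) (U : Set (E d)) : ℝ≥0∞ :=
  ⨆ (Φ : E d → Matrix (Fin d) (Fin d) ℝ) (_ : IsTestField U Φ), ENNReal.ofReal (symGradPairing u Φ)

/-- `u|_U ∈ BD(U)`. -/
def IsBD (u : L1loc d) (U : Set (E d)) : Prop :=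
  IntegrableOn u.fn U volume ∧ symGradVar u U < ⊤

/-! ### The classes of functionals -/

/-- Bounded open sets. -/
def IsBddOpen (U : Set (E d)) : Prop := IsOpen U ∧ Bornology.IsBounded U

/-- Functionals `L¹_loc(ℝ^d; ℝ^d) × 𝓑(ℝ^d) → [0, ∞]`. Only the values on Borel sets matter. -/
abbrev Functional (d : ℕ) : Type := L1loc d → Set (E d) → ℝ≥0∞

/-- The fixed constants `c₁, …, c₇`, the exponent `α` and the modulus `σ`. -/
structure Params where
  (c₁ c₂ c₃ c₄ c₅ c₆ c₇ : ℝ≥0)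
  c₁_pos : 0 < c₁
  c₁_le_c₃ : c₁ ≤ c₃
  α : ℝ
  α_pos : 0 < α
  α_lt_one : α < 1
  σ : ℝ≥0 → ℝ≥0
  σ_continuous : Continuous σ
  σ_zero : σ 0 = 0
  σ_slope : limsup (fun t : ℝ≥0 => ((σ t / t : ℝ≥0) : ℝ≥0∞)) atTop < ⊤

/-- The class `𝔉`. -/
structure MemF (p : Params) (F : Functional d) : Prop where
  /-- `F(u, ·)` is a Borel measure … -/
  measure : ∀ u, ∃ μ : Measure (E d), ∀ B, MeasurableSet B → F u B = μ B
  /-- … determined by its values on open sets. -/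
  outer : ∀ u B, MeasurableSet B → F u B = ⨅ (U : Set (E d)) (_ : IsOpen U) (_ : B ⊆ U), F u U
  /-- Locality on bounded open sets. -/
  locality : ∀ U, IsBddOpen U → ∀ u v : L1loc d,
    (∀ᵐ x ∂(volume.restrict U), u.fn x = v.fn x) → F u U = F v U
  /-- Lower bound `c₁|Eu|(U) - c₂ ℒ(U) ≤ F(u,U)`. -/
  lower : ∀ U, IsBddOpen U → ∀ u, IsBD u U → p.c₁ * symGradVar u U ≤ F u U + p.c₂ * volume U
  /-- Upper bound `F(u,U) ≤ c₃|Eu|(U) + c₄ ℒ(U)`. -/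
  upper : ∀ U, IsBddOpen U → ∀ u, IsBD u U → F u U ≤ p.c₃ * symGradVar u U + p.c₄ * volume U
  /-- The functional is infinite off `BD(U)`. -/
  infinite : ∀ U, IsBddOpen U → ∀ u, ¬ IsBD u U → F u U = ⊤
  /-- Invariance under rigid motions. -/
  rigid : ∀ u (A : Matrix (Fin d) (Fin d) ℝ) (b : E d) B, A.transpose = -A → MeasurableSet B →
    F (u + affineFn A b) B = F u B
  /-- Bulk continuity estimate. -/
  bulk : ∀ u (A : Matrix (Fin d) (Fin d) ℝ) B, A.IsSymm → MeasurableSet B →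
    F (u + affineFn A 0) B ≤ F u B + p.c₅ * ENNReal.ofReal (frob A) * volume B
  /-- Surface continuity estimate. -/
  surface : ∀ u (x ζ ν : E d) B, ‖ν‖ = 1 → MeasurableSet B →
    F (u + jumpFn x ζ ν) B ≤ F u B + p.σ ‖ζ‖₊ * μHE[d - 1] (B ∩ hyperplane x ν)

/-- The quantitative recession-rate inequality (g). For functionals in `𝔉` all the values involved
are finite, so that `toReal` does not lose anything. -/
def RecessionRate (p : Params) (F : Functional d) : Prop :=
  ∀ U, IsBddOpen U → ∀ u, IsBD u U → ∀ s t : ℝ, 0 < s → 0 < t →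
    |(F (s • u) U).toReal / s - (F (t • u) U).toReal / t| ≤
      p.c₆ / s * volume.real U ^ p.α * (F (s • u) U).toReal ^ (1 - p.α)
      + p.c₆ / s * volume.real U
      + p.c₆ / t * volume.real U ^ p.α * (F (t • u) U).toReal ^ (1 - p.α)
      + p.c₆ / t * volume.real U
      + p.c₇ * ((F (s • u) U).toReal / s + (F (t • u) U).toReal / t) * (1 / s + 1 / t)

/-- The class `𝔉^{α,∞}`. -/
structure MemFAlpha (p : Params) (F : Functional d) : Prop where
  memF : MemF p F
  rate : RecessionRate p F

/-- The class `𝔉^{α,∞}_sc`. -/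
structure MemFAlphaSc (p : Params) (F : Functional d) : Prop where
  memFAlpha : MemFAlpha p F
  lsc : ∀ U : Set (E d), IsOpen U → LowerSemicontinuous fun u : L1loc d => F u U

/-! ### Γ-convergence and extension to Borel sets -/

/-- Sequential Γ-convergence in `L¹_loc` (whose topology is pseudometrizable). -/
structure GammaConverges (G : ℕ → L1loc d → ℝ≥0∞) (G₀ : L1loc d → ℝ≥0∞) : Prop where
  liminf_le : ∀ (u : L1loc d) (v : ℕ → L1loc d), Tendsto v atTop (𝓝 u) →
    G₀ u ≤ liminf (fun n => G n (v n)) atTop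
  recovery : ∀ u : L1loc d, ∃ v : ℕ → L1loc d, Tendsto v atTop (𝓝 u) ∧
    Tendsto (fun n => G n (v n)) atTop (𝓝 (G₀ u))

/-- The extension to Borel sets of a functional given on bounded open sets: first to open sets by
monotone limits, and then to Borel sets by outer regularity. It only uses the values of `F` on
bounded open sets. -/
def borelExt (F : Functional d) : Functional d := fun u B =>
  ⨅ (U : Set (E d)) (_ : IsOpen U) (_ : B ⊆ U),
    ⨆ (V : Set (E d)) (_ : IsBddOpen V) (_ : V ⊆ U), F u V

end BDGamma

end

noncomputable section

namespace BDGamma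

variable {d : ℕ}

/-! The proof is the De Giorgi–Letta method. On bounded open sets the Γ-limit inherits monotonicity,
locality, both growth bounds, superadditivity on disjoint sets and the translation estimates, by
inserting suitable competitors into the definition of Γ-convergence. Subadditivity is the real
difficulty, because recovery sequences on two sets have to be glued.

The gluing is the fundamental estimate (`CutoffFamily.sum_glue_le`,
`IsGammaLimit.le_add_of_subset_union`). Among `N` cut-offs with transition layers in disjoint
strips, the average extra cost is a fixed energy divided by `N`, plus an `L¹` error that vanishes in
the limit for each fixed `N`. Inside a strip the growth bounds compare energies with `|Eu|`, and the
Leibniz rule for `|Eu|` (`symGradVar_blend_le`) controls the glued function. Tightness of `|Eu|` and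
of Lebesgue measure on open sets gives inner regularity (`le_of_forall_compactly`), which removes
the compact set from the fundamental estimate and yields countable subadditivity. Superadditivity on
disjoint open sets makes the induced outer measure a metric one, so Borel sets are Carathéodory
measurable and the extension is a measure. Estimates with an error term pass from open to Borel sets
because the error measures are outer regular.

For inequality (g), a recovery sequence for `s • u`, rescaled by `t / s`, is a competitor for `t •
u`. It gives only a lower bound on the liminf of its energies, and `sub_rpow_sub_le_of_le` shows
that this is enough. Finally, any functional in `𝔉` is determined by its values on bounded open
sets, which gives the equivalence. -/

@[simp] theorem L1loc.fn_add (u v : L1loc d) : (u + v).fn = u.fn + v.fn := rfl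
@[simp] theorem L1loc.fn_sub (u v : L1loc d) : (u - v).fn = u.fn - v.fn := rfl
@[simp] theorem L1loc.fn_smul (c : ℝ) (u : L1loc d) : (c • u).fn = c • u.fn := rfl
@[simp] theorem L1loc.fn_mk (f : E d → E d) (hf : LocallyIntegrable f volume) :
    (L1loc.mk f hf).fn = f := rfl

/-! ### Convergence, cutting and pasting in `L¹_loc`. -/

theorem L1loc.nhds_eq (u : L1loc d) :
    𝓝 u = ⨅ n : ℕ, comap (L1loc.restrictBall n) (𝓝 (L1loc.restrictBall n u)) := by
  rw [nhds_iInf]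
  simp only [nhds_induced]

/-- Needed to extract sequences from neighbourhood filters, since Γ-convergence is formulated
sequentially. -/
instance : FirstCountableTopology (L1loc d) :=
  ⟨fun u => by rw [L1loc.nhds_eq]; infer_instance⟩

/-- Convergence in `L¹_loc` is convergence in `L¹` of each closed ball. -/
theorem L1loc.tendsto_iff {ι : Type*} {l : Filter ι} {v : ι → L1loc d} {u : L1loc d} :
    Tendsto v l (𝓝 u) ↔ ∀ k : ℕ, Tendsto
      (fun i => ∫⁻ x in Metric.closedBall (0 : E d) k, ‖(v i).fn x - u.fn x‖ₑ) l (𝓝 0) := by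
  rw [L1loc.nhds_eq, tendsto_iInf]
  refine forall_congr' fun k => ?_
  rw [tendsto_comap_iff, tendsto_iff_edist_tendsto_0]
  refine tendsto_congr fun i => ?_
  simp only [Function.comp, L1loc.restrictBall]
  rw [Integrable.edist_toL1_toL1]
  simp only [edist_eq_enorm_sub]

theorem L1loc.tendsto_lintegral_of_isBounded {ι : Type*} {l : Filter ι} {v : ι → L1loc d}
    {u : L1loc d} (h : Tendsto v l (𝓝 u)) {S : Set (E d)} (hS : Bornology.IsBounded S) :
    Tendsto (fun i => ∫⁻ x in S, ‖(v i).fn x - u.fn x‖ₑ) l (𝓝 0) := by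
  obtain ⟨r, hr⟩ := hS.subset_closedBall 0
  obtain ⟨k, hk⟩ := exists_nat_ge r
  refine tendsto_of_tendsto_of_tendsto_of_le_of_le tendsto_const_nhds (L1loc.tendsto_iff.1 h k)
    (fun _ => zero_le) fun i => lintegral_mono_set (hr.trans (Metric.closedBall_subset_closedBall hk))

/-- Convergence in `L¹_loc` from a bound by sequences converging in `L¹_loc`. -/
theorem L1loc.tendsto_of_le {ι : Type*} {l : Filter ι} {v w z : ι → L1loc d} {u₁ u₂ u : L1loc d}
    (hv : Tendsto v l (𝓝 u₁)) (hw : Tendsto w l (𝓝 u₂)) (c : ℝ≥0)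
    (h : ∀ i x, ‖(z i).fn x - u.fn x‖ₑ ≤
      c * (‖(v i).fn x - u₁.fn x‖ₑ + ‖(w i).fn x - u₂.fn x‖ₑ)) :
    Tendsto z l (𝓝 u) := by
  rw [L1loc.tendsto_iff] at hv hw ⊢
  intro k
  have h0 := ENNReal.Tendsto.const_mul (a := (c : ℝ≥0∞)) ((hv k).add (hw k)) (by simp)
  simp only [add_zero, mul_zero] at h0
  refine tendsto_of_tendsto_of_tendsto_of_le_of_le tendsto_const_nhds h0 (fun _ => zero_le) ?_
  intro i
  dsimp only
  have hm : AEMeasurable (fun x => ‖(v i).fn x - u₁.fn x‖ₑ)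
      (volume.restrict (Metric.closedBall (0 : E d) k)) :=
    (((v i).integrable_restrict k).aestronglyMeasurable.sub
      (u₁.integrable_restrict k).aestronglyMeasurable).enorm
  rw [← lintegral_add_left' hm, ← lintegral_const_mul' _ _ (by simp)]
  exact lintegral_mono fun x => h i x

theorem L1loc.tendsto_add_const {ι : Type*} {l : Filter ι} {v : ι → L1loc d} {u : L1loc d}
    (hv : Tendsto v l (𝓝 u)) (w : L1loc d) : Tendsto (fun i => v i + w) l (𝓝 (u + w)) :=
  L1loc.tendsto_of_le hv hv 1 fun i x => by simp

theorem L1loc.tendsto_const_smul {ι : Type*} {l : Filter ι} {v : ι → L1loc d} {u : L1loc d}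
    (hv : Tendsto v l (𝓝 u)) (c : ℝ) : Tendsto (fun i => c • v i) l (𝓝 (c • u)) :=
  L1loc.tendsto_of_le hv hv ‖c‖₊ fun i x => by
    simp only [L1loc.fn_smul, Pi.smul_apply, ← smul_sub, enorm_smul]
    gcongr
    · simp [enorm_eq_nnnorm]
    · exact le_self_add

theorem L1loc.integrableOn (u : L1loc d) {U : Set (E d)} (hU : Bornology.IsBounded U) :
    IntegrableOn u.fn U volume := by
  obtain ⟨r, hr⟩ := hU.subset_closedBall 0
  exact (u.locallyIntegrable.integrableOn_isCompact (isCompact_closedBall 0 r)).mono_set hr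

theorem isBD_iff {u : L1loc d} {U : Set (E d)} (hU : IsBddOpen U) :
    IsBD u U ↔ symGradVar u U < ⊤ := by
  simp [IsBD, u.integrableOn hU.2]

/-- The function equal to `u` on `U` and to `v` elsewhere. -/
def L1loc.piecewise (U : Set (E d)) (hU : MeasurableSet U) (u v : L1loc d) : L1loc d :=
  L1loc.mk (U.indicator u.fn + Uᶜ.indicator v.fn)
    ((u.locallyIntegrable.indicator hU).add (v.locallyIntegrable.indicator hU.compl))

theorem L1loc.piecewise_apply_mem {U : Set (E d)} (hU : MeasurableSet U) (u v : L1loc d) {x : E d}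
    (hx : x ∈ U) : (L1loc.piecewise U hU u v).fn x = u.fn x := by
  simp [L1loc.piecewise, hx]

theorem L1loc.piecewise_apply_notMem {U : Set (E d)} (hU : MeasurableSet U) (u v : L1loc d)
    {x : E d} (hx : x ∉ U) : (L1loc.piecewise U hU u v).fn x = v.fn x := by
  simp [L1loc.piecewise, hx]

/-- The convex combination `φ u + (1 - φ) v` with a continuous coefficient. -/
def L1loc.blend (φ : E d → ℝ) (hφ : Continuous φ) (u v : L1loc d) : L1loc d :=
  L1loc.mk (fun x => φ x • u.fn x + (1 - φ x) • v.fn x)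
    ((by
      have h := (u.locallyIntegrable.locallyIntegrableOn Set.univ).continuousOn_smul
        isOpen_univ.isLocallyClosed hφ.continuousOn
      have h' := (v.locallyIntegrable.locallyIntegrableOn Set.univ).continuousOn_smul
        isOpen_univ.isLocallyClosed
        (continuous_const.sub hφ : Continuous (fun x => 1 - φ x)).continuousOn
      exact (locallyIntegrableOn_univ.1 h).add (locallyIntegrableOn_univ.1 h')))

theorem L1loc.blend_apply (φ : E d → ℝ) (hφ : Continuous φ) (u v : L1loc d) (x : E d) :
    (L1loc.blend φ hφ u v).fn x = φ x • u.fn x + (1 - φ x) • v.fn x := rfl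

theorem L1loc.tendsto_blend {ι : Type*} {l : Filter ι} {v w : ι → L1loc d} {u : L1loc d}
    (hv : Tendsto v l (𝓝 u)) (hw : Tendsto w l (𝓝 u)) (φ : E d → ℝ) (hφ : Continuous φ)
    (h0 : ∀ x, 0 ≤ φ x) (h1 : ∀ x, φ x ≤ 1) :
    Tendsto (fun i => L1loc.blend φ hφ (v i) (w i)) l (𝓝 u) :=
  L1loc.tendsto_of_le hv hw 1 fun i x => by
    have : (L1loc.blend φ hφ (v i) (w i)).fn x - u.fn x =
        φ x • ((v i).fn x - u.fn x) + (1 - φ x) • ((w i).fn x - u.fn x) := by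
      rw [L1loc.blend_apply]; module
    rw [this, ENNReal.coe_one, one_mul]
    refine (enorm_add_le _ _).trans ?_
    have key : ∀ (t : ℝ) (z : E d), 0 ≤ t → t ≤ 1 → ‖t • z‖ₑ ≤ ‖z‖ₑ := fun t z ht0 ht1 => by
      rw [enorm_le_iff_norm_le, norm_smul, Real.norm_of_nonneg ht0]
      exact mul_le_of_le_one_left (norm_nonneg _) ht1
    exact add_le_add (key _ _ (h0 x) (h1 x)) (key _ _ (by linarith [h1 x]) (by linarith [h0 x]))

theorem L1loc.tendsto_piecewise {ι : Type*} {l : Filter ι} {w : ι → L1loc d} {u v : L1loc d}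
    (hw : Tendsto w l (𝓝 u)) {U : Set (E d)} (hU : MeasurableSet U)
    (huv : ∀ᵐ x ∂(volume.restrict U), u.fn x = v.fn x) :
    Tendsto (fun i => L1loc.piecewise U hU (w i) v) l (𝓝 v) := by
  rw [L1loc.tendsto_iff] at hw ⊢
  intro k
  refine tendsto_of_tendsto_of_tendsto_of_le_of_le tendsto_const_nhds (hw k) (fun _ => zero_le) ?_
  intro i
  refine lintegral_mono_ae (ae_restrict_of_ae ?_)
  filter_upwards [(ae_restrict_iff' hU).1 huv] with x hx
  by_cases hxU : x ∈ U
  · rw [L1loc.piecewise_apply_mem hU _ _ hxU, hx hxU]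
  · simp [L1loc.piecewise_apply_notMem hU _ _ hxU]

/-! ### Test fields and the symmetric gradient -/

theorem frob_smul (c : ℝ) (A : Matrix (Fin d) (Fin d) ℝ) : frob (c • A) = |c| * frob A := by
  simp only [frob, Matrix.smul_apply, smul_eq_mul, mul_pow, ← Finset.mul_sum]
  rw [Real.sqrt_mul (sq_nonneg c), Real.sqrt_sq_eq_abs]

theorem abs_apply_le_frob (A : Matrix (Fin d) (Fin d) ℝ) (i j : Fin d) : |A i j| ≤ frob A := by
  rw [frob, ← Real.sqrt_sq_eq_abs]
  refine Real.sqrt_le_sqrt ?_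
  refine le_trans ?_ (Finset.single_le_sum (f := fun i => ∑ j, A i j ^ 2)
    (fun i _ => Finset.sum_nonneg fun j _ => sq_nonneg _) (Finset.mem_univ i))
  exact Finset.single_le_sum (f := fun j => A i j ^ 2) (fun j _ => sq_nonneg _) (Finset.mem_univ j)

theorem abs_coord_le_norm (z : E d) (i : Fin d) : |z i| ≤ ‖z‖ := by
  simpa using PiLp.norm_apply_le z i

theorem L1loc.locallyIntegrable_coord (u : L1loc d) (i : Fin d) :
    LocallyIntegrable (fun x => u.fn x i) volume := by
  refine u.locallyIntegrable.mono ?_ (Eventually.of_forall fun x => ?_)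
  · exact (EuclideanSpace.proj (𝕜 := ℝ) i).continuous.comp_aestronglyMeasurable
      u.locallyIntegrable.aestronglyMeasurable
  · simpa using abs_coord_le_norm (u.fn x) i

/-- Vector fields with continuous, compactly supported components. -/
def IsContCompact (h : E d → Fin d → ℝ) : Prop :=
  ∀ i, Continuous (fun x => h x i) ∧ HasCompactSupport (fun x => h x i)

theorem IsContCompact.integrable {h : E d → Fin d → ℝ} (hh : IsContCompact h) (u : L1loc d) :
    Integrable (fun x => ∑ i, u.fn x i * h x i) volume := by
  refine integrable_finsetSum _ fun i _ => ?_
  have := (u.locallyIntegrable_coord i).integrable_smul_left_of_hasCompactSupport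
    (hh i).1 (hh i).2
  simpa [mul_comm] using this

theorem enorm_sum_mul_le (z : E d) (h : Fin d → ℝ) (C : ℝ≥0) (hC : ∀ i, |h i| ≤ C) :
    ‖∑ i, z i * h i‖ₑ ≤ (d * C : ℝ≥0) * ‖z‖ₑ := by
  have h1 : ‖∑ i, z i * h i‖ ≤ d * C * ‖z‖ := by
    refine (norm_sum_le _ _).trans ?_
    have : ∀ i ∈ (Finset.univ : Finset (Fin d)), ‖z i * h i‖ ≤ C * ‖z‖ := fun i _ => by
      rw [norm_mul, mul_comm]
      exact mul_le_mul (hC i) (abs_coord_le_norm z i) (norm_nonneg _) C.2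
    refine (Finset.sum_le_sum this).trans ?_
    simp [mul_assoc]
  rw [enorm_eq_nnnorm, enorm_eq_nnnorm, ← ENNReal.coe_mul, ENNReal.coe_le_coe]
  exact_mod_cast h1

/-- Pairings with a bounded field supported in `S` are controlled by the `L¹(S)` norm. -/
theorem enorm_integral_sum_mul_le (w : L1loc d) (h : E d → Fin d → ℝ) (C : ℝ≥0)
    (hC : ∀ x i, |h x i| ≤ C) {S : Set (E d)} (hS : MeasurableSet S)
    (h0 : ∀ x ∉ S, h x = 0) :
    ‖∫ x, ∑ i, w.fn x i * h x i‖ₑ ≤ (d * C : ℝ≥0) * ∫⁻ x in S, ‖w.fn x‖ₑ := by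
  refine (enorm_integral_le_lintegral_enorm _).trans ?_
  rw [← lintegral_const_mul' _ _ ENNReal.coe_ne_top, ← lintegral_indicator hS]
  refine lintegral_mono fun x => ?_
  by_cases hx : x ∈ S
  · rw [Set.indicator_of_mem hx]
    exact enorm_sum_mul_le _ _ _ (hC x)
  · simp [h0 x hx]

theorem IsContCompact.exists_bound {h : E d → Fin d → ℝ} (hh : IsContCompact h) :
    ∃ C : ℝ≥0, ∀ x i, |h x i| ≤ C := by
  have : ∀ i, ∃ C : ℝ, ∀ x, ‖h x i‖ ≤ C := fun i =>
    (hh i).2.exists_bound_of_continuous (hh i).1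
  choose C hC using this
  refine ⟨∑ i, (C i).toNNReal, fun x i => (hC i x).trans ((Real.le_coe_toNNReal _).trans ?_)⟩
  exact_mod_cast Finset.single_le_sum (f := fun i => (C i).toNNReal) (fun _ _ => zero_le)
    (Finset.mem_univ i)

namespace IsTestField

variable {U V : Set (E d)} {Φ Ψ : E d → Matrix (Fin d) (Fin d) ℝ}

theorem mono (h : IsTestField U Φ) (hUV : U ⊆ V) : IsTestField V Φ :=
  ⟨h.smooth, h.compact, h.support.trans hUV, h.symm, h.bound⟩

theorem rowDiv_eq_zero {x : E d} (hx : x ∉ tsupport Φ) (i : Fin d) : rowDiv Φ x i = 0 := by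
  refine Finset.sum_eq_zero fun j _ => ?_
  have : (fun y => Φ y i j) =ᶠ[𝓝 x] fun _ => 0 := by
    filter_upwards [(isClosed_tsupport Φ).isOpen_compl.mem_nhds hx] with y hy
    rw [image_eq_zero_of_notMem_tsupport hy]; rfl
  rw [this.fderiv_eq]; simp

theorem isContCompact_rowDiv (h : IsTestField U Φ) : IsContCompact (rowDiv Φ) := fun i => by
  refine ⟨continuous_finsetSum _ fun j _ => ?_, ?_⟩
  · exact ((h.smooth i j).continuous_fderiv (by simp)).clm_apply continuous_const
  · exact HasCompactSupport.intro h.compact fun x hx => rowDiv_eq_zero hx i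

/-- The supports are disjoint, so at each point at most one summand is nonzero and the bound by `1`
survives. -/
theorem add (hΦ : IsTestField U Φ) (hΨ : IsTestField (U \ tsupport Φ) Ψ) :
    IsTestField U (Φ + Ψ) where
  smooth i j := (hΦ.smooth i j).add (hΨ.smooth i j)
  compact := hΦ.compact.add hΨ.compact
  support := (tsupport_add _ _).trans
    (Set.union_subset hΦ.support (hΨ.support.trans Set.sdiff_subset))
  symm x := (hΦ.symm x).add (hΨ.symm x)
  bound x := by
    by_cases hx : x ∈ tsupport Φ
    · have : x ∉ tsupport Ψ := fun h => (hΨ.support h).2 hx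
      simpa [image_eq_zero_of_notMem_tsupport this] using hΦ.bound x
    · simpa [image_eq_zero_of_notMem_tsupport hx] using hΨ.bound x

theorem smul (hΦ : IsTestField U Φ) {φ : E d → ℝ} (hφ : ContDiff ℝ ∞ φ)
    (h0 : ∀ x, 0 ≤ φ x) (h1 : ∀ x, φ x ≤ 1) : IsTestField U (fun x => φ x • Φ x) where
  smooth i j := by
    simp only [Matrix.smul_apply, smul_eq_mul]
    exact hφ.mul (hΦ.smooth i j)
  compact := HasCompactSupport.intro hΦ.compact fun x hx => by
    rw [image_eq_zero_of_notMem_tsupport hx, smul_zero]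
  support := (closure_minimal (fun x hx => by
    by_contra h
    exact hx (by simp [image_eq_zero_of_notMem_tsupport h])) (isClosed_tsupport Φ)).trans hΦ.support
  symm x := (hΦ.symm x).smul _
  bound x := by
    rw [frob_smul, abs_of_nonneg (h0 x)]
    exact mul_le_one₀ (h1 x) (Real.sqrt_nonneg _) (hΦ.bound x)

end IsTestField

theorem rowDiv_smul {Φ : E d → Matrix (Fin d) (Fin d) ℝ} {φ : E d → ℝ} {x : E d}
    (hΦ : ∀ i j, DifferentiableAt ℝ (fun y => Φ y i j) x) (hφ : DifferentiableAt ℝ φ x)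
    (i : Fin d) :
    rowDiv (fun x => φ x • Φ x) x i =
      φ x * rowDiv Φ x i + ∑ j, Φ x i j * fderiv ℝ φ x (EuclideanSpace.single j 1) := by
  simp only [rowDiv, Matrix.smul_apply, smul_eq_mul, Finset.mul_sum, ← Finset.sum_add_distrib]
  refine Finset.sum_congr rfl fun j _ => ?_
  rw [fderiv_fun_mul hφ (hΦ i j)]
  simp

theorem rowDiv_add {Φ Ψ : E d → Matrix (Fin d) (Fin d) ℝ} {x : E d}
    (hΦ : ∀ i j, DifferentiableAt ℝ (fun y => Φ y i j) x)
    (hΨ : ∀ i j, DifferentiableAt ℝ (fun y => Ψ y i j) x) (i : Fin d) :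
    rowDiv (Φ + Ψ) x i = rowDiv Φ x i + rowDiv Ψ x i := by
  simp only [rowDiv, ← Finset.sum_add_distrib, Pi.add_apply, Matrix.add_apply]
  refine Finset.sum_congr rfl fun j _ => ?_
  rw [fderiv_fun_add (hΦ i j) (hΨ i j)]
  rfl

section Variation

variable {U V : Set (E d)} {Φ Ψ : E d → Matrix (Fin d) (Fin d) ℝ}

theorem IsTestField.differentiableAt (h : IsTestField U Φ) (x : E d) (i j : Fin d) :
    DifferentiableAt ℝ (fun y => Φ y i j) x :=
  ((h.smooth i j).differentiable (by simp)) x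

theorem IsTestField.le_symGradVar (h : IsTestField U Φ) (u : L1loc d) :
    ENNReal.ofReal (symGradPairing u Φ) ≤ symGradVar u U :=
  le_iSup₂_of_le (f := fun Φ (_ : IsTestField U Φ) => ENNReal.ofReal (symGradPairing u Φ))
    Φ h le_rfl

theorem symGradVar_mono (u : L1loc d) (h : U ⊆ V) : symGradVar u U ≤ symGradVar u V :=
  iSup₂_le fun _ hΦ => (hΦ.mono h).le_symGradVar u

theorem symGradPairing_smul (c : ℝ) (u : L1loc d) :
    symGradPairing (c • u) Φ = c * symGradPairing u Φ := by
  simp only [symGradPairing, L1loc.fn_smul, Pi.smul_apply, PiLp.smul_apply, smul_eq_mul, mul_assoc,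
    ← Finset.mul_sum, integral_const_mul, mul_neg]

theorem symGradVar_smul_le {c : ℝ} (hc : 0 ≤ c) (u : L1loc d) :
    symGradVar (c • u) U ≤ ENNReal.ofReal c * symGradVar u U :=
  iSup₂_le fun Φ hΦ => by
    rw [symGradPairing_smul, ENNReal.ofReal_mul hc]
    gcongr
    exact hΦ.le_symGradVar u

theorem IsBD.smul {u : L1loc d} (h : IsBD u U) {c : ℝ} (hc : 0 ≤ c) : IsBD (c • u) U :=
  ⟨h.1.smul c, (symGradVar_smul_le hc u).trans_lt (ENNReal.mul_lt_top ENNReal.ofReal_lt_top h.2)⟩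

theorem IsTestField.tendsto_pairing (h : IsTestField U Φ) {ι : Type*} {l : Filter ι}
    {v : ι → L1loc d} {u : L1loc d} (hv : Tendsto v l (𝓝 u)) :
    Tendsto (fun i => symGradPairing (v i) Φ) l (𝓝 (symGradPairing u Φ)) := by
  obtain ⟨C, hC⟩ := h.isContCompact_rowDiv.exists_bound
  have h0 := ENNReal.Tendsto.const_mul (a := ((d * C : ℝ≥0) : ℝ≥0∞))
    (L1loc.tendsto_lintegral_of_isBounded hv h.compact.isBounded) (.inr ENNReal.coe_ne_top)
  rw [mul_zero] at h0
  rw [tendsto_iff_edist_tendsto_0]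
  refine tendsto_of_tendsto_of_tendsto_of_le_of_le tendsto_const_nhds h0 (fun _ => zero_le) ?_
  intro i
  have := enorm_integral_sum_mul_le (v i - u) (rowDiv Φ) C hC (isClosed_tsupport Φ).measurableSet
    fun x hx => funext fun i => IsTestField.rowDiv_eq_zero hx i
  refine le_trans (le_of_eq ?_) this
  dsimp only
  rw [edist_eq_enorm_sub, symGradPairing, symGradPairing, ← enorm_neg]
  rw [neg_sub_neg, neg_sub, ← integral_sub (h.isContCompact_rowDiv.integrable _)
    (h.isContCompact_rowDiv.integrable _)]
  simp [sub_mul]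

/-- Lower semicontinuity of the total variation. -/
theorem symGradVar_le_liminf {ι : Type*} {l : Filter ι} [l.NeBot]
    {v : ι → L1loc d} {u : L1loc d} (hv : Tendsto v l (𝓝 u)) (U : Set (E d)) :
    symGradVar u U ≤ liminf (fun i => symGradVar (v i) U) l :=
  iSup₂_le fun Φ hΦ => by
    rw [← (ENNReal.tendsto_ofReal (hΦ.tendsto_pairing hv)).liminf_eq]
    exact liminf_le_liminf (Eventually.of_forall fun i => hΦ.le_symGradVar (v i))

/-- A quantitative superadditivity: a field supported off `tsupport Φ` can be added to `Φ` without
breaking the constraint. If `Φ` almost attains the variation, little is left outside its support,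
which is the source of tightness. -/
theorem IsTestField.ofReal_pairing_add_le (hΦ : IsTestField U Φ) (u : L1loc d) :
    ENNReal.ofReal (symGradPairing u Φ) + symGradVar u (U \ tsupport Φ) ≤ symGradVar u U := by
  unfold symGradVar
  -- The zero field shows that the supremum is over a nonempty family.
  rw [ENNReal.add_biSup' ⟨0, ⟨fun i j => contDiff_const, HasCompactSupport.zero,
    by simp [tsupport], fun _ => by simp, fun _ => by simp [frob]⟩⟩]
  refine iSup₂_le fun Ψ hΨ => ?_
  rcases le_total (symGradPairing u Φ) 0 with h0 | h0
  · rw [ENNReal.ofReal_of_nonpos h0, zero_add]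
    exact (hΨ.mono Set.sdiff_subset).le_symGradVar u
  rcases le_total (symGradPairing u Ψ) 0 with h1 | h1
  · rw [ENNReal.ofReal_of_nonpos h1, add_zero]
    exact hΦ.le_symGradVar u
  rw [← ENNReal.ofReal_add h0 h1]
  have : symGradPairing u (Φ + Ψ) = symGradPairing u Φ + symGradPairing u Ψ := by
    rw [symGradPairing, symGradPairing, symGradPairing, ← neg_add,
      ← integral_add (hΦ.isContCompact_rowDiv.integrable u)
        (hΨ.isContCompact_rowDiv.integrable u)]
    simp only [rowDiv_add (hΦ.differentiableAt _) (hΨ.differentiableAt _), mul_add,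
      Finset.sum_add_distrib]
  rw [← this]
  exact (hΦ.add hΨ).le_symGradVar u

/-- The total variation of a finite symmetric gradient is tight. -/
theorem exists_isCompact_symGradVar_diff_le {u : L1loc d} (h : symGradVar u U < ⊤) {ε : ℝ≥0∞}
    (hε : ε ≠ 0) : ∃ K ⊆ U, IsCompact K ∧ symGradVar u (U \ K) ≤ ε := by
  rcases eq_or_ne (symGradVar u U) 0 with h0 | h0
  · exact ⟨∅, by simp, isCompact_empty, by simp [h0]⟩
  have hlt : symGradVar u U - ε < symGradVar u U := ENNReal.sub_lt_self h.ne h0 hε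
  obtain ⟨Φ, hΦ⟩ := lt_iSup_iff.1 (hlt.trans_le (le_of_eq rfl))
  obtain ⟨hΦ, hlt⟩ := lt_iSup_iff.1 hΦ
  refine ⟨tsupport Φ, hΦ.support, hΦ.compact, ?_⟩
  have h1 := hΦ.ofReal_pairing_add_le u
  have h2 : symGradVar u U ≤ ENNReal.ofReal (symGradPairing u Φ) + ε :=
    tsub_le_iff_right.1 hlt.le
  exact (ENNReal.add_le_add_iff_left ENNReal.ofReal_ne_top).1 (h1.trans h2)

theorem symGradVar_le_of_forall_compactly (u : L1loc d) {M : ℝ≥0∞} (hU : IsOpen U)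
    (h : ∀ V, IsOpen V → IsCompact (closure V) → closure V ⊆ U → symGradVar u V ≤ M) :
    symGradVar u U ≤ M :=
  iSup₂_le fun Φ hΦ => by
    obtain ⟨V, hV, hKV, hVU, hVc⟩ := exists_open_between_and_isCompact_closure hΦ.compact hU
      hΦ.support
    have : IsTestField V Φ := ⟨hΦ.smooth, hΦ.compact, hKV, hΦ.symm, hΦ.bound⟩
    exact (this.le_symGradVar u).trans (h V hV hVc hVU)

/-- Leibniz estimate for the total variation of the symmetric gradient of a convex combination. -/
theorem symGradVar_blend_le {φ : E d → ℝ} (hφ : ContDiff ℝ ∞ φ) (h0 : ∀ x, 0 ≤ φ x)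
    (h1 : ∀ x, φ x ≤ 1) {C : ℝ≥0} (hC : ∀ x, ‖fderiv ℝ φ x‖ ≤ C) (u v : L1loc d)
    {S : Set (E d)} (hS : IsOpen S) :
    symGradVar (L1loc.blend φ hφ.continuous u v) S ≤ symGradVar u S + symGradVar v S +
      (d * (d * C) : ℝ≥0) * ∫⁻ x in S, ‖u.fn x - v.fn x‖ₑ := by
  refine iSup₂_le fun Φ hΦ => ?_
  have hφ' : ContDiff ℝ ∞ (fun x => 1 - φ x) := contDiff_const.sub hφ
  have hΦ1 := hΦ.smul hφ h0 h1
  have hΦ2 := hΦ.smul hφ' (fun x => by linarith [h1 x]) (fun x => by linarith [h0 x])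
  set R : E d → Fin d → ℝ := fun x i => ∑ j, Φ x i j * fderiv ℝ φ x (EuclideanSpace.single j 1)
    with hR
  have hR0 : ∀ x ∉ tsupport Φ, R x = 0 := fun x hx => funext fun i => by
    simp [hR, image_eq_zero_of_notMem_tsupport hx]
  have hRC : IsContCompact R := fun i => by
    refine ⟨continuous_finsetSum _ fun j _ => ((hΦ.smooth i j).continuous).mul
      ((hφ.continuous_fderiv (by simp)).clm_apply continuous_const), ?_⟩
    exact HasCompactSupport.intro hΦ.compact fun x hx => by rw [hR0 x hx]; rfl
  have hRb : ∀ x i, |R x i| ≤ (d * C : ℝ≥0) := fun x i => by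
    refine (Finset.abs_sum_le_sum_abs _ _).trans ?_
    have : ∀ j ∈ (Finset.univ : Finset (Fin d)),
        |Φ x i j * fderiv ℝ φ x (EuclideanSpace.single j 1)| ≤ C := fun j _ => by
      rw [abs_mul]
      refine (mul_le_of_le_one_left (abs_nonneg _)
        ((abs_apply_le_frob _ i j).trans (hΦ.bound x))).trans ?_
      refine ((fderiv ℝ φ x).le_opNorm _).trans ?_
      simpa using hC x
    refine (Finset.sum_le_sum this).trans ?_
    simp
  have hdiff : ∀ x, DifferentiableAt ℝ φ x := fun x => (hφ.differentiable (by simp)) x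
  have hfd : ∀ x, fderiv ℝ (fun x => 1 - φ x) x = -fderiv ℝ φ x := fun x => by
    rw [fderiv_const_sub]
  -- From `φ div Φ = div (φ Φ) - Φ ∇φ` and the same identity for `1 - φ`: the two gradient terms
  -- combine into the pairing of `u - v` with `R = Φ ∇φ`.
  have hkey : symGradPairing (L1loc.blend φ hφ.continuous u v) Φ =
      symGradPairing u (fun x => φ x • Φ x) + symGradPairing v (fun x => (1 - φ x) • Φ x) +
        ∫ x, ∑ i, (u - v).fn x i * R x i := by
    simp only [symGradPairing]
    rw [← neg_add, ← integral_add (hΦ1.isContCompact_rowDiv.integrable u)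
        (hΦ2.isContCompact_rowDiv.integrable v), ← integral_neg, ← integral_neg,
        ← integral_add _ (hRC.integrable _)]
    · refine integral_congr_ae (Eventually.of_forall fun x => ?_)
      simp only [← Finset.sum_add_distrib, ← Finset.sum_neg_distrib]
      refine Finset.sum_congr rfl fun i _ => ?_
      rw [rowDiv_smul (hΦ.differentiableAt x) (hdiff x),
        rowDiv_smul (hΦ.differentiableAt x) ((hdiff x).const_sub 1), hfd]
      simp only [neg_apply, mul_neg, Finset.sum_neg_distrib]
      rw [L1loc.blend_apply]
      simp only [PiLp.add_apply, PiLp.smul_apply, smul_eq_mul, L1loc.fn_sub, Pi.sub_apply,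
        PiLp.sub_apply, hR]
      ring
    · exact ((hΦ1.isContCompact_rowDiv.integrable u).add
        (hΦ2.isContCompact_rowDiv.integrable v)).neg
  rw [hkey]
  refine ENNReal.ofReal_add_le.trans (add_le_add (ENNReal.ofReal_add_le.trans
    (add_le_add (hΦ1.le_symGradVar u) (hΦ2.le_symGradVar v))) ?_)
  have h3 := enorm_integral_sum_mul_le (u - v) R (d * C) hRb hS.measurableSet
    fun x hx => hR0 x fun h => hx (hΦ.support h)
  refine le_trans ?_ h3
  rw [← ofReal_norm]
  exact ENNReal.ofReal_le_ofReal (le_abs_self _)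

end Variation

/-! ### Consequences of Γ-convergence -/

/-- The liminf inequality at `u` self-improves to a bound that is uniform over a neighbourhood of
`u` and all large `n`. Recovery sequences of nearby points eventually enter that neighbourhood. -/
theorem GammaConverges.lowerSemicontinuous {G : ℕ → L1loc d → ℝ≥0∞} {G₀ : L1loc d → ℝ≥0∞}
    (h : GammaConverges G G₀) : LowerSemicontinuous G₀ := by
  intro u c hc
  obtain ⟨c', hcc', hc'⟩ := exists_between hc
  have key : ∀ᶠ q in 𝓝 u ×ˢ (atTop : Filter ℕ), c' < G q.2 q.1 := by
    by_contra hcon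
    obtain ⟨q, hq, hqc⟩ := exists_seq_forall_of_frequently (not_eventually.1 hcon)
    have hq1 : Tendsto (fun k => (q k).1) atTop (𝓝 u) := tendsto_fst.comp hq
    have hq2 : Tendsto (fun k => (q k).2) atTop atTop := tendsto_snd.comp hq
    obtain ⟨s, hs, hs2⟩ := strictMono_subseq_of_tendsto_atTop hq2
    set n : ℕ → ℕ := fun k => (q (s k)).2 with hn
    -- The violating points are indexed only by the subsequence `n k`; filling the gaps with the
    -- constant `u` gives a full sequence converging to `u`, to which the liminf inequality applies.
    set v : ℕ → L1loc d := Function.extend n (fun k => (q (s k)).1) (fun _ => u) with hv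
    have hvn : ∀ k, v (n k) = (q (s k)).1 := fun k => hs2.injective.extend_apply _ _ _
    have hvt : Tendsto v atTop (𝓝 u) := by
      rw [tendsto_def]
      intro S hS
      obtain ⟨K, hK⟩ := eventually_atTop.1 ((hq1.comp hs.tendsto_atTop).eventually hS)
      refine mem_atTop_sets.2 ⟨n K, fun m hm => ?_⟩
      by_cases hmr : ∃ k, n k = m
      · obtain ⟨k, rfl⟩ := hmr
        rw [Set.mem_preimage, hvn]
        exact hK k (hs2.le_iff_le.1 hm)
      · rw [Set.mem_preimage, hv, Function.extend_apply' _ _ _ hmr]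
        exact mem_of_mem_nhds hS
    have h1 := h.liminf_le u v hvt
    have h2 : liminf (fun m => G m (v m)) atTop ≤ c' := by
      refine liminf_le_of_frequently_le' ?_
      rw [frequently_atTop]
      intro N
      refine ⟨n N, hs2.le_apply, ?_⟩
      rw [hvn]
      exact not_lt.1 (hqc (s N))
    exact absurd (h1.trans h2) (not_le.2 hc')
  obtain ⟨P, hP, Q, hQ, hPQ⟩ := eventually_prod_iff.1 key
  -- The iterated form makes `P` hold in a whole neighbourhood of `w`, not only at `w`.
  filter_upwards [eventually_eventually_nhds.2 hP] with w hw
  obtain ⟨v, hv, hvG⟩ := h.recovery w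
  refine hcc'.trans_le (ge_of_tendsto hvG ?_)
  filter_upwards [hv.eventually hw, hQ] with n hn1 hn2
  exact (hPQ hn1 hn2).le

theorem liminf_add_liminf_le (f g : ℕ → ℝ≥0∞) :
    liminf f atTop + liminf g atTop ≤ liminf (fun n => f n + g n) atTop := by
  simp only [liminf_eq_iSup_iInf_of_nat]
  rw [ENNReal.iSup_add_iSup_of_monotone]
  · refine iSup_mono fun n => le_iInf₂ fun i hi => ?_
    exact add_le_add (iInf₂_le i hi) (iInf₂_le i hi)
  · exact fun a b hab => le_iInf₂ fun i hi => iInf₂_le i (le_trans hab hi)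
  · exact fun a b hab => le_iInf₂ fun i hi => iInf₂_le i (le_trans hab hi)

/-- The common pattern for monotonicity, locality and translations: a recovery sequence for `G₀` is
modified into a competitor for `H₀`. -/
theorem GammaConverges.le_of_forall_exists {G H : ℕ → L1loc d → ℝ≥0∞} {G₀ H₀ : L1loc d → ℝ≥0∞}
    (hG : GammaConverges G G₀) (hH : GammaConverges H H₀) {u w : L1loc d} {a : ℝ≥0∞}
    (h : ∀ v : ℕ → L1loc d, Tendsto v atTop (𝓝 u) → ∃ z : ℕ → L1loc d, Tendsto z atTop (𝓝 w) ∧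
      ∀ n, H n (z n) ≤ G n (v n) + a) : H₀ w ≤ G₀ u + a := by
  obtain ⟨v, hv, hvG⟩ := hG.recovery u
  obtain ⟨z, hz, hzG⟩ := h v hv
  refine (hH.liminf_le w z hz).trans ?_
  rw [← (hvG.add_const a).liminf_eq]
  exact liminf_le_liminf (Eventually.of_forall hzG)

/-! ### Elementary properties of the class `𝔉` -/

namespace MemF

variable {p : Params} {G : Functional d}

theorem mono (h : MemF p G) (u : L1loc d) {B C : Set (E d)} (hB : MeasurableSet B)
    (hC : MeasurableSet C) (hBC : B ⊆ C) : G u B ≤ G u C := by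
  obtain ⟨μ, hμ⟩ := h.measure u
  rw [hμ B hB, hμ C hC]
  exact measure_mono hBC

theorem le_add_of_subset_union (h : MemF p G) (u : L1loc d) {B C D : Set (E d)}
    (hB : MeasurableSet B) (hC : MeasurableSet C) (hD : MeasurableSet D) (hBCD : B ⊆ C ∪ D) :
    G u B ≤ G u C + G u D := by
  obtain ⟨μ, hμ⟩ := h.measure u
  rw [hμ B hB, hμ C hC, hμ D hD]
  exact (measure_mono hBCD).trans (measure_union_le _ _)

theorem add_of_disjoint (h : MemF p G) (u : L1loc d) {B C : Set (E d)}
    (hB : MeasurableSet B) (hC : MeasurableSet C) (hBC : Disjoint B C) :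
    G u B + G u C = G u (B ∪ C) := by
  obtain ⟨μ, hμ⟩ := h.measure u
  rw [hμ B hB, hμ C hC, hμ _ (hB.union hC), measure_union hBC hC]

theorem sum_le (h : MemF p G) (u : L1loc d) {ι : Type*} (s : Finset ι) {T : ι → Set (E d)}
    {B : Set (E d)} (hT : ∀ i, MeasurableSet (T i)) (hB : MeasurableSet B)
    (hTB : ∀ i, T i ⊆ B) (hd : Pairwise (Function.onFun Disjoint T)) :
    ∑ i ∈ s, G u (T i) ≤ G u B := by
  obtain ⟨μ, hμ⟩ := h.measure u
  simp only [hμ _ (hT _), hμ B hB]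
  rw [← measure_biUnion_finset (hd.set_pairwise _) fun i _ => hT i]
  exact measure_mono (Set.iUnion₂_subset fun i _ => hTB i)

/-- Off `BD(U)` the variation is infinite and `c₃ ≥ c₁ > 0`, so the right side is `⊤`. Dropping the
`BD` hypothesis allows use along arbitrary sequences. -/
theorem le_upper (h : MemF p G) (u : L1loc d) {U : Set (E d)} (hU : IsBddOpen U) :
    G u U ≤ p.c₃ * symGradVar u U + p.c₄ * volume U := by
  by_cases hb : IsBD u U
  · exact h.upper U hU u hb
  · have : symGradVar u U = ⊤ := by simpa [isBD_iff hU] using hb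
    have h3 : (p.c₃ : ℝ≥0∞) ≠ 0 := by
      simpa using (p.c₁_pos.trans_le p.c₁_le_c₃).ne'
    rw [this, ENNReal.mul_top h3, top_add]
    exact le_top

theorem lower_le (h : MemF p G) (u : L1loc d) {U : Set (E d)} (hU : IsBddOpen U) :
    p.c₁ * symGradVar u U ≤ G u U + p.c₂ * volume U := by
  by_cases hb : IsBD u U
  · exact h.lower U hU u hb
  · rw [h.infinite U hU u hb, top_add]
    exact le_top

theorem congr_on (h : MemF p G) {u v : L1loc d} {U : Set (E d)} (hU : IsBddOpen U)
    (huv : ∀ x ∈ U, u.fn x = v.fn x) : G u U = G v U :=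
  h.locality U hU u v ((ae_restrict_iff' hU.1.measurableSet).2 (Eventually.of_forall huv))

end MemF

theorem IsBddOpen.volume_lt_top {U : Set (E d)} (hU : IsBddOpen U) : volume U < ⊤ :=
  hU.2.measure_lt_top

theorem IsBddOpen.inter {U V : Set (E d)} (hU : IsBddOpen U) (hV : IsOpen V) :
    IsBddOpen (U ∩ V) := ⟨hU.1.inter hV, hU.2.subset Set.inter_subset_left⟩

theorem IsBddOpen.subset {U V : Set (E d)} (hU : IsBddOpen U) (hV : IsOpen V) (h : V ⊆ U) :
    IsBddOpen V := ⟨hV, hU.2.subset h⟩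

theorem IsBddOpen.union {U V : Set (E d)} (hU : IsBddOpen U) (hV : IsBddOpen V) :
    IsBddOpen (U ∪ V) := ⟨hU.1.union hV.1, hU.2.union hV.2⟩

/-- `F(·, U)` is the Γ-limit of functionals in the class `𝔉` for every bounded open set `U`. -/
structure IsGammaLimit (p : Params) (Fn : ℕ → Functional d) (F : Functional d) : Prop where
  mem : ∀ n, MemF p (Fn n)
  conv : ∀ U : Set (E d), IsBddOpen U → GammaConverges (fun n u => Fn n u U) (fun u => F u U)

namespace IsGammaLimit

variable {p : Params} {Fn : ℕ → Functional d} {F : Functional d}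

theorem mono (h : IsGammaLimit p Fn F) (u : L1loc d) {U V : Set (E d)} (hU : IsBddOpen U)
    (hV : IsBddOpen V) (hUV : U ⊆ V) : F u U ≤ F u V := by
  have := (h.conv V hV).le_of_forall_exists (h.conv U hU) (u := u) (w := u) (a := 0)
    fun v hv => ⟨v, hv, fun n => by
      simpa using (h.mem n).mono (v n) hU.1.measurableSet hV.1.measurableSet hUV⟩
  simpa using this

theorem upper (h : IsGammaLimit p Fn F) (u : L1loc d) {U : Set (E d)} (hU : IsBddOpen U) :
    F u U ≤ p.c₃ * symGradVar u U + p.c₄ * volume U := by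
  refine ((h.conv U hU).liminf_le u _ tendsto_const_nhds).trans ?_
  refine (liminf_le_liminf (Eventually.of_forall fun n => (h.mem n).le_upper u hU)).trans ?_
  exact (tendsto_const_nhds.liminf_eq).le

/-- Lower semicontinuity of the variation along a recovery sequence. -/
theorem lower (h : IsGammaLimit p Fn F) (u : L1loc d) {U : Set (E d)} (hU : IsBddOpen U) :
    p.c₁ * symGradVar u U ≤ F u U + p.c₂ * volume U := by
  obtain ⟨v, hv, hvF⟩ := (h.conv U hU).recovery u
  have h1 : p.c₁ * symGradVar u U ≤ liminf (fun n => p.c₁ * symGradVar (v n) U) atTop := by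
    refine (mul_le_mul_right (symGradVar_le_liminf hv U) _).trans ?_
    have hmono : Monotone fun a : ℝ≥0∞ => p.c₁ * a := fun a b hab => mul_le_mul_right hab _
    exact (hmono.map_liminf_of_continuousAt _
      (ENNReal.continuous_const_mul ENNReal.coe_ne_top).continuousAt).le
  refine h1.trans ?_
  rw [← (hvF.add_const _).liminf_eq]
  exact liminf_le_liminf (Eventually.of_forall fun n => (h.mem n).lower_le (v n) hU)

theorem isBD_of_lt_top (h : IsGammaLimit p Fn F) {u : L1loc d} {U : Set (E d)} (hU : IsBddOpen U)
    (hF : F u U < ⊤) : IsBD u U := by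
  rw [isBD_iff hU]
  have h1 : p.c₁ * symGradVar u U < ⊤ := (h.lower u hU).trans_lt
    (ENNReal.add_lt_top.2 ⟨hF, ENNReal.mul_lt_top (by simp) hU.volume_lt_top⟩)
  by_contra hcon
  rw [not_lt, top_le_iff] at hcon
  rw [hcon, ENNReal.mul_top (by simpa using p.c₁_pos.ne')] at h1
  exact lt_irrefl _ h1

theorem infinite (h : IsGammaLimit p Fn F) {u : L1loc d} {U : Set (E d)} (hU : IsBddOpen U)
    (hb : ¬ IsBD u U) : F u U = ⊤ := by
  by_contra hcon
  exact hb (h.isBD_of_lt_top hU (lt_top_iff_ne_top.2 hcon))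

theorem locality_le (h : IsGammaLimit p Fn F) {u v : L1loc d} {U : Set (E d)} (hU : IsBddOpen U)
    (huv : ∀ᵐ x ∂(volume.restrict U), u.fn x = v.fn x) : F v U ≤ F u U := by
  have := (h.conv U hU).le_of_forall_exists (h.conv U hU) (u := u) (w := v) (a := 0)
    fun w hw => ⟨_, L1loc.tendsto_piecewise hw hU.1.measurableSet huv, fun n => by
      rw [add_zero]
      exact ((h.mem n).congr_on hU fun x hx => L1loc.piecewise_apply_mem _ _ _ hx).le⟩
  simpa using this

theorem locality (h : IsGammaLimit p Fn F) {u v : L1loc d} {U : Set (E d)} (hU : IsBddOpen U)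
    (huv : ∀ᵐ x ∂(volume.restrict U), u.fn x = v.fn x) : F u U = F v U :=
  le_antisymm (h.locality_le hU (huv.mono fun _ => Eq.symm)) (h.locality_le hU huv)

/-- A recovery sequence on the union competes on both pieces. -/
theorem add_le_of_disjoint (h : IsGammaLimit p Fn F) (u : L1loc d) {U V : Set (E d)}
    (hU : IsBddOpen U) (hV : IsBddOpen V) (hUV : Disjoint U V) :
    F u U + F u V ≤ F u (U ∪ V) := by
  obtain ⟨v, hv, hvF⟩ := (h.conv _ (hU.union hV)).recovery u
  rw [← hvF.liminf_eq]
  refine (add_le_add ((h.conv U hU).liminf_le u v hv) ((h.conv V hV).liminf_le u v hv)).trans ?_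
  refine (liminf_add_liminf_le _ _).trans (liminf_le_liminf (Eventually.of_forall fun n => ?_))
  exact ((h.mem n).add_of_disjoint _ hU.1.measurableSet hV.1.measurableSet hUV).le

theorem translate_le (h : IsGammaLimit p Fn F) (u w : L1loc d) {U : Set (E d)}
    (hU : IsBddOpen U) {a : ℝ≥0∞} (ha : ∀ n v, Fn n (v + w) U ≤ Fn n v U + a) :
    F (u + w) U ≤ F u U + a :=
  (h.conv U hU).le_of_forall_exists (h.conv U hU) fun v hv =>
    ⟨_, L1loc.tendsto_add_const hv w, fun n => ha n (v n)⟩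

end IsGammaLimit

/-! ### The fundamental estimate -/

open scoped Manifold in
theorem exists_contDiff_cutoff {K A : Set (E d)} (hK : IsCompact K) (hA : IsOpen A) (hKA : K ⊆ A) :
    ∃ ψ : E d → ℝ, ContDiff ℝ ∞ ψ ∧ HasCompactSupport ψ ∧ (∀ x, 0 ≤ ψ x) ∧ (∀ x ∈ K, ψ x = 1) ∧
      ∀ x ∉ A, ψ x = 0 := by
  obtain ⟨V, hV, hKV, hVA, hVc⟩ := exists_open_between_and_isCompact_closure hK hA hKA
  obtain ⟨f, h0, h1, h01⟩ := exists_contMDiffMap_zero_one_of_isClosed (n := ⊤) 𝓘(ℝ, E d)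
    hV.isClosed_compl hK.isClosed (Set.disjoint_compl_left_iff_subset.2 hKV)
  refine ⟨f, f.contMDiff.contDiff, ?_, fun x => (h01 x).1, fun x hx => h1 hx,
    fun x hx => h0 fun h => hx (hVA (subset_closure h))⟩
  exact HasCompactSupport.intro hVc fun x hx => h0 fun h => hx (subset_closure h)

/-- A family of cut-off functions between `K` and `A` with transition layers in disjoint strips. -/
structure CutoffFamily (K A : Set (E d)) (N : ℕ) where
  (φ : Fin N → E d → ℝ)
  (S P Z : Fin N → Set (E d))
  C : ℝ≥0
  contDiff : ∀ i, ContDiff ℝ ∞ (φ i)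
  nonneg : ∀ i x, 0 ≤ φ i x
  le_one : ∀ i x, φ i x ≤ 1
  fderiv_le : ∀ i x, ‖fderiv ℝ (φ i) x‖ ≤ C
  isOpen_S : ∀ i, IsOpen (S i)
  isOpen_P : ∀ i, IsOpen (P i)
  isOpen_Z : ∀ i, IsOpen (Z i)
  eq_one : ∀ i, ∀ x ∈ P i, φ i x = 1
  eq_zero : ∀ i, ∀ x ∈ Z i, φ i x = 0
  cover : ∀ i x, x ∈ P i ∨ x ∈ Z i ∨ x ∈ S i
  disjoint : Pairwise (Function.onFun Disjoint S)
  P_subset : ∀ i, P i ⊆ A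
  S_subset : ∀ i, S i ⊆ A
  Z_notMem : ∀ i, ∀ x ∈ Z i, x ∉ K
  S_notMem : ∀ i, ∀ x ∈ S i, x ∉ K

theorem nonempty_cutoffFamily {K A : Set (E d)} (hK : IsCompact K) (hA : IsOpen A) (hKA : K ⊆ A)
    (N : ℕ) : Nonempty (CutoffFamily K A N) := by
  obtain ⟨ψ, hψ, hψc, hψ0, hψ1, hψA⟩ := exists_contDiff_cutoff hK hA hKA
  set g : E d → ℝ := fun x => 3 * N * ψ x with hg
  have hgs : ContDiff ℝ ∞ g := contDiff_const.mul hψ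
  have hgc : Continuous g := hgs.continuous
  have hgK : ∀ x ∈ K, g x = 3 * N := fun x hx => by simp [hg, hψ1 x hx]
  have hgA : ∀ x, 0 < g x → x ∈ A := fun x hx => by
    by_contra h
    simp [hg, hψA x h] at hx
  have hiN : ∀ i : Fin N, ((i : ℕ) : ℝ) + 1 ≤ N := fun i => by exact_mod_cast i.2
  have hi0 : ∀ i : Fin N, (0 : ℝ) ≤ (i : ℕ) := fun i => Nat.cast_nonneg _
  -- The range `[0, 3N]` of `g` between the outside of `A` and `K` is split into `N` intervals of
  -- length 3. The transition of `φ i` takes place in the middle third of the `i`-th one; the outer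
  -- thirds give room for open sets `P`, `Z`, `S` that cover the whole space.
  set φ : Fin N → E d → ℝ := fun i x => Real.smoothTransition (g x - (3 * (i : ℕ) + 1)) with hφ
  have hφs : ∀ i, ContDiff ℝ ∞ (φ i) := fun i =>
    Real.smoothTransition.contDiff.comp (hgs.sub contDiff_const)
  have hφc : ∀ i, HasCompactSupport (φ i) := fun i => HasCompactSupport.intro hψc fun x hx =>
    Real.smoothTransition.zero_of_nonpos (by
      have := hi0 i
      simp only [hg, image_eq_zero_of_notMem_tsupport hx]
      linarith)
  have hb : ∀ i, ∃ C : ℝ, ∀ x, ‖fderiv ℝ (φ i) x‖ ≤ C := fun i =>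
    ((hφc i).fderiv (𝕜 := ℝ)).exists_bound_of_continuous ((hφs i).continuous_fderiv (by simp))
  choose C hC using hb
  refine ⟨{
    φ := φ
    S := fun i => {x | (3 * (i : ℕ) : ℝ) < g x ∧ g x < 3 * (i : ℕ) + 3}
    P := fun i => {x | (3 * (i : ℕ) + 2 : ℝ) < g x}
    Z := fun i => {x | g x < (3 * (i : ℕ) + 1 : ℝ)}
    C := ∑ i, (C i).toNNReal
    contDiff := hφs
    nonneg := fun i x => Real.smoothTransition.nonneg _
    le_one := fun i x => Real.smoothTransition.le_one _
    fderiv_le := fun i x => ?_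
    isOpen_S := fun i => (isOpen_lt continuous_const hgc).inter (isOpen_lt hgc continuous_const)
    isOpen_P := fun i => isOpen_lt continuous_const hgc
    isOpen_Z := fun i => isOpen_lt hgc continuous_const
    eq_one := fun i x hx => Real.smoothTransition.one_of_one_le ?_
    eq_zero := fun i x hx => Real.smoothTransition.zero_of_nonpos ?_
    cover := fun i x => ?_
    disjoint := fun i j hij => Set.disjoint_left.2 fun x hx hy => hij ?_
    P_subset := fun i x hx => hgA x ?_
    S_subset := fun i x hx => hgA x (lt_of_le_of_lt (by linarith [hi0 i]) hx.1)
    Z_notMem := fun i x hx hxK => ?_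
    S_notMem := fun i x hx hxK => ?_ }⟩
  · refine (hC i x).trans ((Real.le_coe_toNNReal _).trans ?_)
    exact_mod_cast Finset.single_le_sum (f := fun i => (C i).toNNReal) (fun _ _ => zero_le)
      (Finset.mem_univ i)
  · have : (3 * (i : ℕ) + 2 : ℝ) < g x := hx
    linarith
  · have : g x < (3 * (i : ℕ) + 1 : ℝ) := hx
    linarith
  · simp only [Set.mem_ofPred_eq]
    by_cases h1 : (3 * (i : ℕ) + 2 : ℝ) < g x
    · exact .inl h1
    by_cases h2 : g x < (3 * (i : ℕ) + 1 : ℝ)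
    · exact .inr (.inl h2)
    exact .inr (.inr ⟨by linarith, by linarith⟩)
  · obtain ⟨h1, h2⟩ := hx
    obtain ⟨h3, h4⟩ := hy
    have h5 : ((i : ℕ) : ℝ) < (j : ℕ) + 1 := by linarith
    have h6 : ((j : ℕ) : ℝ) < (i : ℕ) + 1 := by linarith
    have h5' : (i : ℕ) < j + 1 := by exact_mod_cast h5
    have h6' : (j : ℕ) < i + 1 := by exact_mod_cast h6
    exact Fin.ext (by omega)
  · have : (3 * (i : ℕ) + 2 : ℝ) < g x := hx
    linarith [hi0 i]
  · have : g x < (3 * (i : ℕ) + 1 : ℝ) := hx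
    linarith [hgK x hxK, hiN i]
  · linarith [hgK x hxK, hiN i, hx.2]

namespace CutoffFamily

variable {K A : Set (E d)} {N : ℕ}

/-- The function `φᵢ u + (1 - φᵢ) v`. -/
def glue (c : CutoffFamily K A N) (i : Fin N) (u v : L1loc d) : L1loc d :=
  L1loc.blend (c.φ i) (c.contDiff i).continuous u v

theorem tendsto_glue (c : CutoffFamily K A N) (i : Fin N) {ι : Type*} {l : Filter ι}
    {v w : ι → L1loc d} {u : L1loc d} (hv : Tendsto v l (𝓝 u)) (hw : Tendsto w l (𝓝 u)) :
    Tendsto (fun k => c.glue i (v k) (w k)) l (𝓝 u) :=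
  L1loc.tendsto_blend hv hw _ _ (c.nonneg i) (c.le_one i)

/-- In a strip, the gluing costs a fixed multiple of the energies plus an `L¹` error. -/
theorem strip_le (c : CutoffFamily K A N) {p : Params} {G : Functional d} (hG : MemF p G)
    (i : Fin N) (u v : L1loc d) {T : Set (E d)} (hT : IsBddOpen T) :
    G (c.glue i u v) T ≤ (p.c₃ / p.c₁ : ℝ≥0) * (G u T + G v T) +
      (2 * (p.c₃ / p.c₁ * p.c₂) + p.c₄ : ℝ≥0) * volume T +
      (p.c₃ * (d * (d * c.C)) : ℝ≥0) * ∫⁻ x in T, ‖u.fn x - v.fn x‖ₑ := by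
  -- Passing from energy to variation and back costs the factor `c₃ / c₁`.
  have hκ : (p.c₃ : ℝ≥0∞) = (p.c₃ / p.c₁ : ℝ≥0) * p.c₁ := by
    rw [← ENNReal.coe_mul, div_mul_cancel₀ _ p.c₁_pos.ne']
  have key : ∀ w : L1loc d, p.c₃ * symGradVar w T ≤
      (p.c₃ / p.c₁ : ℝ≥0) * (G w T + p.c₂ * volume T) := fun w => by
    rw [hκ, mul_assoc]
    exact mul_le_mul_right (hG.lower_le w hT) _
  refine (hG.le_upper _ hT).trans ?_
  have h1 := symGradVar_blend_le (c.contDiff i) (c.nonneg i) (c.le_one i) (c.fderiv_le i) u v hT.1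
  calc _ ≤ p.c₃ * (symGradVar u T + symGradVar v T +
        (d * (d * c.C) : ℝ≥0) * ∫⁻ x in T, ‖u.fn x - v.fn x‖ₑ) + p.c₄ * volume T := by
        gcongr
        exact h1
    _ = p.c₃ * symGradVar u T + p.c₃ * symGradVar v T + (p.c₃ * (d * (d * c.C)) : ℝ≥0) *
        (∫⁻ x in T, ‖u.fn x - v.fn x‖ₑ) + p.c₄ * volume T := by
        rw [ENNReal.coe_mul p.c₃]; ring
    _ ≤ (p.c₃ / p.c₁ : ℝ≥0) * (G u T + p.c₂ * volume T) +
        (p.c₃ / p.c₁ : ℝ≥0) * (G v T + p.c₂ * volume T) + (p.c₃ * (d * (d * c.C)) : ℝ≥0) *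
        (∫⁻ x in T, ‖u.fn x - v.fn x‖ₑ) + p.c₄ * volume T := by
        exact add_le_add_left (add_le_add_left (add_le_add (key u) (key v)) _) _
    _ = _ := by
        rw [ENNReal.coe_add, ENNReal.coe_mul 2, ENNReal.coe_mul _ p.c₂, ENNReal.coe_ofNat]
        ring

/-- On `P i` the glued function is `u` and the set lies in `A`; on `Z i` it is `v`, and that part of
`W` avoids `K`, hence lies in `B`. Openness of these sets is what lets locality apply. -/
theorem glue_le (c : CutoffFamily K A N) {p : Params} {G : Functional d} (hG : MemF p G)
    (i : Fin N) (u v : L1loc d) (hA : IsBddOpen A) {B W : Set (E d)} (hB : IsBddOpen B)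
    (hW : IsBddOpen W) (hWKB : W ⊆ K ∪ B) :
    G (c.glue i u v) W ≤ G u A + G v B + G (c.glue i u v) (W ∩ c.S i) := by
  have hWP := hW.inter (c.isOpen_P i)
  have hWZ := hW.inter (c.isOpen_Z i)
  have hWS := hW.inter (c.isOpen_S i)
  have h1 : G (c.glue i u v) (W ∩ c.P i) ≤ G u A := by
    rw [hG.congr_on (v := u) hWP fun x hx => by
      simp [glue, L1loc.blend_apply, c.eq_one i x hx.2]]
    exact hG.mono u hWP.1.measurableSet hA.1.measurableSet
      (Set.inter_subset_right.trans (c.P_subset i))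
  have h2 : G (c.glue i u v) (W ∩ c.Z i) ≤ G v B := by
    rw [hG.congr_on (v := v) hWZ fun x hx => by
      simp [glue, L1loc.blend_apply, c.eq_zero i x hx.2]]
    exact hG.mono v hWZ.1.measurableSet hB.1.measurableSet fun x hx =>
      (hWKB hx.1).resolve_left (c.Z_notMem i x hx.2)
  refine (hG.le_add_of_subset_union _ hW.1.measurableSet
    (hWP.union hWZ).1.measurableSet hWS.1.measurableSet fun x hx => ?_).trans
    (add_le_add_left ((hG.le_add_of_subset_union _ (hWP.union hWZ).1.measurableSet
      hWP.1.measurableSet hWZ.1.measurableSet subset_rfl).trans (add_le_add h1 h2)) _)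
  rcases c.cover i x with h | h | h
  · exact .inl (.inl ⟨hx, h⟩)
  · exact .inl (.inr ⟨hx, h⟩)
  · exact .inr ⟨hx, h⟩

/-- Summing over disjoint strips, the strip energies add up to at most one copy of the total
energies, without a factor `N`. Only the `L¹` error, which tends to zero, carries that factor. -/
theorem sum_glue_le (c : CutoffFamily K A N) {p : Params} {G : Functional d} (hG : MemF p G)
    (u v : L1loc d) (hA : IsBddOpen A) {B W : Set (E d)} (hB : IsBddOpen B)
    (hW : IsBddOpen W) (hWKB : W ⊆ K ∪ B) :
    ∑ i, G (c.glue i u v) W ≤ N * (G u A + G v B) + ((p.c₃ / p.c₁ : ℝ≥0) * (G u A + G v B) +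
      (2 * (p.c₃ / p.c₁ * p.c₂) + p.c₄ : ℝ≥0) * volume W) +
      N * ((p.c₃ * (d * (d * c.C)) : ℝ≥0) * ∫⁻ x in W, ‖u.fn x - v.fn x‖ₑ) := by
  have hWS := fun i => hW.inter (c.isOpen_S i)
  have hm := fun i => (hWS i).1.measurableSet
  have hd : Pairwise (Function.onFun Disjoint fun i => W ∩ c.S i) := fun i j hij =>
    (c.disjoint hij).mono Set.inter_subset_right Set.inter_subset_right
  have hu : ∑ i, G u (W ∩ c.S i) ≤ G u A := hG.sum_le u _ hm hA.1.measurableSet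
    (fun i => Set.inter_subset_right.trans (c.S_subset i)) hd
  have hv : ∑ i, G v (W ∩ c.S i) ≤ G v B := hG.sum_le v _ hm hB.1.measurableSet
    (fun i x hx => (hWKB hx.1).resolve_left (c.S_notMem i x hx.2)) hd
  have hvol : ∑ i, volume (W ∩ c.S i) ≤ volume W := by
    rw [← measure_biUnion_finset (hd.set_pairwise _) fun i _ => hm i]
    exact measure_mono (Set.iUnion₂_subset fun i _ => Set.inter_subset_left)
  have hstep : ∀ i, G (c.glue i u v) W ≤ G u A + G v B +
      ((p.c₃ / p.c₁ : ℝ≥0) * (G u (W ∩ c.S i) + G v (W ∩ c.S i)) +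
      (2 * (p.c₃ / p.c₁ * p.c₂) + p.c₄ : ℝ≥0) * volume (W ∩ c.S i) +
      (p.c₃ * (d * (d * c.C)) : ℝ≥0) * ∫⁻ x in W, ‖u.fn x - v.fn x‖ₑ) := fun i => by
    refine (c.glue_le hG i u v hA hB hW hWKB).trans ?_
    gcongr
    refine (c.strip_le hG i u v (hWS i)).trans ?_
    gcongr
    exact Set.inter_subset_left
  refine (Finset.sum_le_sum fun i _ => hstep i).trans ?_
  simp only [Finset.sum_add_distrib, ← Finset.mul_sum, Finset.sum_const, Finset.card_univ,
    Fintype.card_fin, nsmul_eq_mul]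
  rw [← mul_add, ← add_assoc, mul_left_comm (N : ℝ≥0∞) ((p.c₃ * (d * (d * c.C)) : ℝ≥0) : ℝ≥0∞)]
  gcongr

end CutoffFamily

namespace IsGammaLimit

variable {p : Params} {Fn : ℕ → Functional d} {F : Functional d}

/-- The fundamental estimate for the Γ-limit. -/
theorem le_add_of_subset_union (h : IsGammaLimit p Fn F) (u : L1loc d) {K A B W : Set (E d)}
    (hK : IsCompact K) (hA : IsBddOpen A) (hKA : K ⊆ A) (hB : IsBddOpen B) (hW : IsBddOpen W)
    (hWKB : W ⊆ K ∪ B) : F u W ≤ F u A + F u B := by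
  rcases eq_or_ne (F u A + F u B) ⊤ with htop | htop
  · rw [htop]; exact le_top
  obtain ⟨v, hv, hvF⟩ := (h.conv A hA).recovery u
  obtain ⟨w, hw, hwF⟩ := (h.conv B hB).recovery u
  set M : ℝ≥0∞ := (p.c₃ / p.c₁ : ℝ≥0) * (F u A + F u B) +
      (2 * (p.c₃ / p.c₁ * p.c₂) + p.c₄ : ℝ≥0) * volume W with hM
  have hMtop : M ≠ ⊤ := ENNReal.add_ne_top.2 ⟨ENNReal.mul_ne_top ENNReal.coe_ne_top htop,
    ENNReal.mul_ne_top ENNReal.coe_ne_top hW.volume_lt_top.ne⟩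
  have hvw : Tendsto (fun n => ∫⁻ x in W, ‖(v n).fn x - (w n).fn x‖ₑ) atTop (𝓝 0) := by
    have h0 := (L1loc.tendsto_lintegral_of_isBounded hv hW.2).add
      (L1loc.tendsto_lintegral_of_isBounded hw hW.2)
    rw [add_zero] at h0
    refine tendsto_of_tendsto_of_tendsto_of_le_of_le tendsto_const_nhds h0 (fun _ => zero_le) ?_
    intro n
    dsimp only
    have hm : AEMeasurable (fun x => ‖(v n).fn x - u.fn x‖ₑ) (volume.restrict W) :=
      (((v n).integrableOn hW.2).aestronglyMeasurable.sub
        (u.integrableOn hW.2).aestronglyMeasurable).enorm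
    rw [← lintegral_add_left' hm]
    refine lintegral_mono fun x => ?_
    have : (v n).fn x - (w n).fn x = ((v n).fn x - u.fn x) - ((w n).fn x - u.fn x) := by abel
    rw [this]
    exact enorm_sub_le
  -- The constant `M` does not depend on `N`, so dividing by `N` and letting `N → ∞` removes it.
  -- Summing over all cut-offs avoids selecting a best strip for each `n`.
  have hN : ∀ N : ℕ, N * F u W ≤ N * (F u A + F u B) + M := by
    intro N
    obtain ⟨c⟩ := nonempty_cutoffFamily hK hA.1 hKA N
    have hlim : Tendsto (fun n => N * (Fn n (v n) A + Fn n (w n) B) +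
        ((p.c₃ / p.c₁ : ℝ≥0) * (Fn n (v n) A + Fn n (w n) B) +
        (2 * (p.c₃ / p.c₁ * p.c₂) + p.c₄ : ℝ≥0) * volume W) +
        N * ((p.c₃ * (d * (d * c.C)) : ℝ≥0) * ∫⁻ x in W, ‖(v n).fn x - (w n).fn x‖ₑ)) atTop
        (𝓝 (N * (F u A + F u B) + M +
          N * ((p.c₃ * (d * (d * c.C)) : ℝ≥0) * 0))) := by
      have hs := hvF.add hwF
      refine ((ENNReal.Tendsto.const_mul hs (.inr (ENNReal.natCast_ne_top N))).add
        ((ENNReal.Tendsto.const_mul hs (.inr ENNReal.coe_ne_top)).add_const _)).add ?_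
      exact ENNReal.Tendsto.const_mul (ENNReal.Tendsto.const_mul hvw (.inr ENNReal.coe_ne_top))
        (.inr (ENNReal.natCast_ne_top N))
    rw [mul_zero, mul_zero, add_zero] at hlim
    -- `F u W` may be infinite, so it is approached from below by `a`, which each of the `N` glued
    -- sequences eventually exceeds.
    refine le_of_forall_lt fun b hb => ?_
    obtain ⟨a, haW, hab⟩ : ∃ a, (N = 0 ∨ a < F u W) ∧ b < N * a := by
      rcases Nat.eq_zero_or_pos N with h0 | h0
      · simp [h0] at hb
      have hN0 : (N : ℝ≥0∞) ≠ 0 := by exact_mod_cast h0.ne'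
      have : b / N < F u W := by
        rw [ENNReal.div_lt_iff (.inl hN0) (.inl (ENNReal.natCast_ne_top N)), mul_comm]
        exact hb
      obtain ⟨a, ha1, ha2⟩ := exists_between this
      rw [ENNReal.div_lt_iff (.inl hN0) (.inl (ENNReal.natCast_ne_top N)), mul_comm] at ha1
      exact ⟨a, .inr ha2, ha1⟩
    refine hab.trans_le (ge_of_tendsto hlim ?_)
    have hev : ∀ i : Fin N, ∀ᶠ n in atTop, a ≤ Fn n (c.glue i (v n) (w n)) W := fun i => by
      have haW : a < F u W := haW.resolve_left fun h0 => (h0 ▸ i).elim0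
      have := (h.conv W hW).liminf_le u _ (c.tendsto_glue i hv hw)
      exact (eventually_lt_of_lt_liminf (haW.trans_le this)).mono fun _ h => h.le
    filter_upwards [eventually_all.2 hev] with n hn
    refine le_trans ?_ (c.sum_glue_le (h.mem n) (v n) (w n) hA hB hW hWKB)
    refine le_trans ?_ (Finset.sum_le_sum fun i _ => hn i)
    simp
  have hN' : ∀ N : ℕ, N ≠ 0 → F u W ≤ F u A + F u B + M / N := fun N h0 => by
    have hN0 : (N : ℝ≥0∞) ≠ 0 := by exact_mod_cast h0
    rw [← ENNReal.mul_le_mul_iff_right hN0 (ENNReal.natCast_ne_top N), mul_add,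
      ENNReal.mul_div_cancel hN0 (ENNReal.natCast_ne_top N)]
    exact hN N
  have hlim : Tendsto (fun N : ℕ => F u A + F u B + M / N) atTop (𝓝 (F u A + F u B + 0)) := by
    refine Tendsto.const_add _ ?_
    have := ENNReal.Tendsto.const_mul (a := M) ENNReal.tendsto_inv_nat_nhds_zero (.inr hMtop)
    simpa [div_eq_mul_inv] using this
  rw [add_zero] at hlim
  exact ge_of_tendsto hlim ((eventually_ne_atTop 0).mono hN')

/-- Inner regularity of the Γ-limit. -/
theorem le_of_forall_compactly (h : IsGammaLimit p Fn F) (u : L1loc d) {U : Set (E d)}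
    (hU : IsBddOpen U) {M : ℝ≥0∞}
    (hM : ∀ V, IsOpen V → IsCompact (closure V) → closure V ⊆ U → F u V ≤ M) : F u U ≤ M := by
  rcases eq_or_ne M ⊤ with htop | htop
  · rw [htop]; exact le_top
  have hc1 : (p.c₁ : ℝ≥0∞) ≠ 0 := by simpa using p.c₁_pos.ne'
  -- The lower growth bound on compactly contained sets forces finite variation on `U`, without
  -- which there is no tightness.
  have hvar : symGradVar u U < ⊤ := by
    refine lt_of_le_of_lt (b := (M + p.c₂ * volume U) / p.c₁)
      (symGradVar_le_of_forall_compactly u hU.1 fun V hV hVc hVU => ?_) ?_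
    · have hVU' := subset_closure.trans hVU
      have hVb := hU.subset hV hVU'
      rw [ENNReal.le_div_iff_mul_le (.inl hc1) (.inl ENNReal.coe_ne_top), mul_comm]
      refine (h.lower u hVb).trans ?_
      gcongr
      exact hM V hV hVc hVU
    · exact ENNReal.div_lt_top (ENNReal.add_ne_top.2 ⟨htop,
        ENNReal.mul_ne_top ENNReal.coe_ne_top hU.volume_lt_top.ne⟩) hc1
  have hlim : Tendsto (fun ε : ℝ≥0∞ => M + (p.c₃ * ε + p.c₄ * ε)) (𝓝[>] 0)
      (𝓝 (M + (p.c₃ * 0 + p.c₄ * 0))) := by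
    refine tendsto_nhdsWithin_of_tendsto_nhds (Tendsto.const_add _ (Tendsto.add ?_ ?_)) <;>
    exact ENNReal.Tendsto.const_mul tendsto_id (.inr ENNReal.coe_ne_top)
  rw [mul_zero, mul_zero, add_zero, add_zero] at hlim
  refine ge_of_tendsto hlim ?_
  filter_upwards [self_mem_nhdsWithin] with ε hε
  have hε0 : ε ≠ 0 := ne_of_gt hε
  -- Off `K₁ ∪ K₂` both the variation and the volume are at most `ε`, so the upper growth bound
  -- makes the energy of the boundary layer small.
  obtain ⟨K₁, hK₁U, hK₁, hK₁ε⟩ := exists_isCompact_symGradVar_diff_le hvar hε0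
  obtain ⟨K₂, hK₂U, hK₂, hK₂ε⟩ := hU.1.measurableSet.exists_isCompact_sdiff_lt
    hU.volume_lt_top.ne hε0
  have hK := hK₁.union hK₂
  have hKU := Set.union_subset hK₁U hK₂U
  obtain ⟨V, hV, hKV, hVU, hVc⟩ := exists_open_between_and_isCompact_closure hK hU.1 hKU
  have hB : IsBddOpen (U \ (K₁ ∪ K₂)) := hU.inter hK.isClosed.isOpen_compl
  refine (h.le_add_of_subset_union u hK (hU.subset hV (subset_closure.trans hVU)) hKV hB hU
    fun x hx => ?_).trans (add_le_add (hM V hV hVc hVU) ((h.upper u hB).trans ?_))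
  · by_cases hxK : x ∈ K₁ ∪ K₂
    · exact .inl hxK
    · exact .inr ⟨hx, hxK⟩
  · gcongr
    · exact (symGradVar_mono u (Set.sdiff_subset_sdiff_right Set.subset_union_left)).trans hK₁ε
    · exact (measure_mono (Set.sdiff_subset_sdiff_right Set.subset_union_right)).trans hK₂ε.le

/-- By inner regularity it suffices to treat `W` with compact closure in `U ∪ V`; that closure
splits into a compact part of `U` and one of `V`, and the fundamental estimate applies. -/
theorem union_le (h : IsGammaLimit p Fn F) (u : L1loc d) {U V : Set (E d)}
    (hU : IsBddOpen U) (hV : IsBddOpen V) : F u (U ∪ V) ≤ F u U + F u V := by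
  refine h.le_of_forall_compactly u (hU.union hV) fun W hW hWc hWUV => ?_
  obtain ⟨K, L, hK, hL, hKU, hLV, hKL⟩ := hWc.binary_compact_cover hU.1 hV.1 hWUV
  refine h.le_add_of_subset_union u hK hU hKU hV
    ((hU.union hV).subset hW (subset_closure.trans hWUV)) fun x hx => ?_
  have : x ∈ K ∪ L := hKL ▸ subset_closure hx
  exact this.imp id fun h => hLV h

end IsGammaLimit

/-! ### The extension to Borel sets -/

section Extension

variable {F : Functional d}

theorem borelExt_mono (F : Functional d) (u : L1loc d) {B C : Set (E d)} (h : B ⊆ C) :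
    borelExt F u B ≤ borelExt F u C :=
  le_iInf fun U => le_iInf₂ fun hU hCU => iInf_le_of_le U (iInf₂_le_of_le hU (h.trans hCU) le_rfl)

theorem borelExt_of_isOpen (F : Functional d) (u : L1loc d) {U : Set (E d)} (hU : IsOpen U) :
    borelExt F u U = ⨆ (V : Set (E d)) (_ : IsBddOpen V) (_ : V ⊆ U), F u V := by
  refine le_antisymm (iInf_le_of_le U (iInf₂_le_of_le hU subset_rfl le_rfl)) ?_
  exact le_iInf fun W => le_iInf₂ fun _ hUW => iSup_mono fun V => iSup_mono fun _ =>
    iSup_mono' fun hVU => ⟨hVU.trans hUW, le_rfl⟩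

theorem le_borelExt (F : Functional d) (u : L1loc d) {U V : Set (E d)} (hV : IsBddOpen V)
    (hVU : V ⊆ U) : F u V ≤ borelExt F u U := by
  refine le_trans ?_ (borelExt_mono F u hVU)
  rw [borelExt_of_isOpen F u hV.1]
  exact le_iSup_of_le V (le_iSup₂_of_le hV subset_rfl le_rfl)

theorem borelExt_le_iff {u : L1loc d} {U : Set (E d)} (hU : IsOpen U) {M : ℝ≥0∞} :
    borelExt F u U ≤ M ↔ ∀ V, IsBddOpen V → V ⊆ U → F u V ≤ M := by
  simp [borelExt_of_isOpen F u hU]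

theorem borelExt_eq_iInf (F : Functional d) (u : L1loc d) (B : Set (E d)) :
    borelExt F u B = ⨅ (U : Set (E d)) (_ : IsOpen U) (_ : B ⊆ U), borelExt F u U :=
  iInf_congr fun _ => iInf_congr fun hU => iInf_congr fun _ => (borelExt_of_isOpen F u hU).symm

/-- Inequalities on bounded open sets, with an outer regular error, extend to Borel sets. -/
theorem borelExt_le_add_measure {u v : L1loc d} (ν : Measure (E d)) [ν.OuterRegular]
    (h : ∀ U, IsBddOpen U → F v U ≤ F u U + ν U) (B : Set (E d)) :
    borelExt F v B ≤ borelExt F u B + ν B := by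
  rw [borelExt_eq_iInf F u B, B.measure_eq_iInf_isOpen ν]
  simp only [ENNReal.iInf_add, ENNReal.add_iInf]
  refine le_iInf fun O => le_iInf₂ fun hBO hO => le_iInf fun U => le_iInf₂ fun hU hBU => ?_
  -- Two open sets, one nearly optimal for each term, are intersected.
  refine (borelExt_mono F v (Set.subset_inter hBU hBO)).trans
    ((borelExt_le_iff (hU.inter hO)).2 fun V hV hVUO => (h V hV).trans ?_)
  exact add_le_add (le_borelExt F u hV (hVUO.trans Set.inter_subset_left))
    (measure_mono (hVUO.trans Set.inter_subset_right))

end Extension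

theorem symGradVar_empty (u : L1loc d) : symGradVar u ∅ = 0 := by
  refine le_antisymm (iSup₂_le fun Φ hΦ => ?_) zero_le
  have : ∀ x i, rowDiv Φ x i = 0 := fun x i =>
    IsTestField.rowDiv_eq_zero (fun hx => (hΦ.support hx).elim) i
  simp [symGradPairing, this]

namespace IsGammaLimit

variable {p : Params} {Fn : ℕ → Functional d} {F : Functional d}

theorem borelExt_eq (h : IsGammaLimit p Fn F) (u : L1loc d) {U : Set (E d)} (hU : IsBddOpen U) :
    borelExt F u U = F u U :=
  le_antisymm ((borelExt_le_iff hU.1).2 fun _ hV hVU => h.mono u hV hU hVU)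
    (le_borelExt F u hU subset_rfl)

theorem borelExt_empty (h : IsGammaLimit p Fn F) (u : L1loc d) : borelExt F u ∅ = 0 := by
  have he : IsBddOpen (∅ : Set (E d)) := ⟨isOpen_empty, Bornology.isBounded_empty⟩
  rw [h.borelExt_eq u he]
  refine le_antisymm ((h.upper u he).trans ?_) zero_le
  simp [symGradVar_empty]

theorem borelExt_union_le (h : IsGammaLimit p Fn F) (u : L1loc d) {U V : Set (E d)}
    (hU : IsOpen U) (hV : IsOpen V) :
    borelExt F u (U ∪ V) ≤ borelExt F u U + borelExt F u V := by
  refine (borelExt_le_iff (hU.union hV)).2 fun W hW hWUV => ?_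
  have : W = (W ∩ U) ∪ (W ∩ V) := by rw [← Set.inter_union_distrib_left,
    Set.inter_eq_left.2 hWUV]
  rw [this]
  exact (h.union_le u (hW.inter hU) (hW.inter hV)).trans (add_le_add
    (le_borelExt F u (hW.inter hU) Set.inter_subset_right)
    (le_borelExt F u (hW.inter hV) Set.inter_subset_right))

theorem borelExt_biUnion_le (h : IsGammaLimit p Fn F) (u : L1loc d) {U : ℕ → Set (E d)}
    (hU : ∀ i, IsOpen (U i)) (s : Finset ℕ) :
    borelExt F u (⋃ i ∈ s, U i) ≤ ∑ i ∈ s, borelExt F u (U i) := by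
  induction s using Finset.induction_on with
  | empty => simp [h.borelExt_empty u]
  | insert a s ha ih =>
    rw [Finset.set_biUnion_insert, Finset.sum_insert ha]
    exact (h.borelExt_union_le u (hU a) (isOpen_biUnion fun i _ => hU i)).trans
      (add_le_add_right ih _)

/-- Inner regularity and compactness reduce a countable cover to a finite one. -/
theorem borelExt_iUnion_le (h : IsGammaLimit p Fn F) (u : L1loc d) {U : ℕ → Set (E d)}
    (hU : ∀ i, IsOpen (U i)) : borelExt F u (⋃ i, U i) ≤ ∑' i, borelExt F u (U i) := by
  refine (borelExt_le_iff (isOpen_iUnion hU)).2 fun V hV hVU => ?_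
  refine h.le_of_forall_compactly u hV fun W hW hWc hWV => ?_
  obtain ⟨s, hs⟩ := hWc.elim_finite_subcover U hU (hWV.trans hVU)
  refine (le_borelExt F u (hV.subset hW (subset_closure.trans hWV))
    (subset_closure.trans hs)).trans ?_
  exact (h.borelExt_biUnion_le u hU s).trans (ENNReal.sum_le_tsum s)

theorem add_borelExt_le (h : IsGammaLimit p Fn F) (u : L1loc d) {U V : Set (E d)}
    (hU : IsOpen U) (hV : IsOpen V) (hUV : Disjoint U V) :
    borelExt F u U + borelExt F u V ≤ borelExt F u (U ∪ V) := by
  have hk : ∀ W₁, IsBddOpen W₁ → W₁ ⊆ U → ∀ W₂, IsBddOpen W₂ → W₂ ⊆ V →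
      F u W₁ + F u W₂ ≤ borelExt F u (U ∪ V) := fun W₁ h₁ h₁U W₂ h₂ h₂V =>
    (h.add_le_of_disjoint u h₁ h₂ (hUV.mono h₁U h₂V)).trans
      (le_borelExt F u (h₁.union h₂) (Set.union_subset_union h₁U h₂V))
  have he : IsBddOpen (∅ : Set (E d)) := ⟨isOpen_empty, Bornology.isBounded_empty⟩
  have h1 : ∀ W₁, IsBddOpen W₁ → W₁ ⊆ U → F u W₁ + borelExt F u V ≤ borelExt F u (U ∪ V) := by
    intro W₁ h₁ h₁U
    simp only [borelExt_of_isOpen F u hV, iSup_and']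
    rw [ENNReal.add_biSup' ⟨∅, he, Set.empty_subset _⟩]
    exact iSup₂_le fun W₂ h₂ => hk W₁ h₁ h₁U W₂ h₂.1 h₂.2
  rw [borelExt_of_isOpen F u hU]
  simp only [iSup_and']
  rw [ENNReal.biSup_add' ⟨∅, he, Set.empty_subset _⟩]
  exact iSup₂_le fun W₁ h₁ => h1 W₁ h₁.1 h₁.2

/-- The outer measure with the given values on open sets. -/
def outerMeasure (F : Functional d) (u : L1loc d) (h0 : borelExt F u ∅ = 0) :
    OuterMeasure (E d) :=
  inducedOuterMeasure (P := IsOpen) (fun U _ => borelExt F u U) isOpen_empty h0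

theorem outerMeasure_apply (h : IsGammaLimit p Fn F) (u : L1loc d) (B : Set (E d)) :
    outerMeasure F u (h.borelExt_empty u) B = borelExt F u B := by
  rw [outerMeasure, inducedOuterMeasure_eq_iInf (fun _ hU => isOpen_iUnion hU)
    (fun _ hU => h.borelExt_iUnion_le u hU) (fun _ _ _ _ hUV => borelExt_mono F u hUV),
    borelExt_eq_iInf F u B]

/-- Sets at distance at least `r` have disjoint open `r / 2`-neighbourhoods, on which
superadditivity for open sets applies; Carathéodory's criterion then makes Borel sets measurable. -/
theorem isMetric_outerMeasure (h : IsGammaLimit p Fn F) (u : L1loc d) :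
    (outerMeasure F u (h.borelExt_empty u)).IsMetric := by
  rintro s t ⟨r, hr0, hr⟩
  refine le_antisymm (measure_union_le s t) ?_
  simp only [h.outerMeasure_apply]
  set U : Set (E d) := {z | Metric.infEDist z s < r / 2} with hUdef
  set V : Set (E d) := {z | Metric.infEDist z t < r / 2} with hVdef
  have hr2 : (0 : ℝ≥0∞) < r / 2 := ENNReal.half_pos hr0
  have hU : IsOpen U := isOpen_lt Metric.continuous_infEDist continuous_const
  have hV : IsOpen V := isOpen_lt Metric.continuous_infEDist continuous_const
  have hUV : Disjoint U V := Set.disjoint_left.2 fun z hzs hzt => by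
    obtain ⟨x, hx, hzx⟩ := Metric.infEDist_lt_iff.1 hzs
    obtain ⟨y, hy, hzy⟩ := Metric.infEDist_lt_iff.1 hzt
    refine absurd (hr x hx y hy) (not_le.2 ?_)
    calc edist x y ≤ edist z x + edist z y := edist_triangle_left x y z
      _ < r / 2 + r / 2 := ENNReal.add_lt_add hzx hzy
      _ = r := ENNReal.add_halves r
  rw [borelExt_eq_iInf F u (s ∪ t)]
  refine le_iInf fun O => le_iInf₂ fun hO hst => ?_
  have hs : s ⊆ O ∩ U := fun x hx => ⟨hst (.inl hx), by
    rw [hUdef, Set.mem_ofPred_eq, Metric.infEDist_zero_of_mem hx]; exact hr2⟩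
  have ht : t ⊆ O ∩ V := fun x hx => ⟨hst (.inr hx), by
    rw [hVdef, Set.mem_ofPred_eq, Metric.infEDist_zero_of_mem hx]; exact hr2⟩
  refine (add_le_add (borelExt_mono F u hs) (borelExt_mono F u ht)).trans ?_
  refine (h.add_borelExt_le u (hO.inter hU) (hO.inter hV)
    (hUV.mono Set.inter_subset_right Set.inter_subset_right)).trans (borelExt_mono F u ?_)
  exact Set.union_subset Set.inter_subset_left Set.inter_subset_left

theorem exists_measure (h : IsGammaLimit p Fn F) (u : L1loc d) :
    ∃ μ : Measure (E d), ∀ B, MeasurableSet B → borelExt F u B = μ B := by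
  refine ⟨(outerMeasure F u (h.borelExt_empty u)).toMeasure ?_, fun B hB => ?_⟩
  · rw [BorelSpace.measurable_eq (α := E d)]
    exact (h.isMetric_outerMeasure u).borel_le_caratheodory
  · rw [toMeasure_apply _ _ hB, h.outerMeasure_apply]

end IsGammaLimit

/-! ### Hausdorff measure on hyperplanes -/

/-- The hyperplane is an isometric copy of `νᗮ`, of dimension `d - 1` (a true subtraction since `1 ≤
d`), and there the normalised Hausdorff measure is Lebesgue measure. -/
theorem isFiniteMeasureOnCompacts_hausdorff_hyperplane (hd : 1 ≤ d) (x : E d) {ν : E d}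
    (hν : ‖ν‖ = 1) :
    IsFiniteMeasureOnCompacts ((μHE[d - 1] : Measure (E d)).restrict (hyperplane x ν)) := by
  have hν0 : ν ≠ 0 := fun h => by simp [h] at hν
  set V : Submodule ℝ (E d) := (Submodule.span ℝ {ν})ᗮ with hV
  have hfin : Module.finrank ℝ V = d - 1 := by
    have : Fact (Module.finrank ℝ (E d) = (d - 1) + 1) := ⟨by
      rw [finrank_euclideanSpace_fin]; omega⟩
    exact Submodule.finrank_orthogonal_span_singleton hν0
  set f : V → E d := fun v => (v : E d) + x with hf
  have hiso : Isometry f := (IsometryEquiv.addRight x).isometry.comp isometry_subtype_coe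
  have hrange : Set.range f = hyperplane x ν := by
    ext y
    simp only [hyperplane, Set.mem_ofPred_eq, Set.mem_range]
    constructor
    · rintro ⟨v, rfl⟩
      have := Submodule.mem_orthogonal_singleton_iff_inner_left.1 v.2
      simpa [hf] using this
    · intro hy
      exact ⟨⟨y - x, Submodule.mem_orthogonal_singleton_iff_inner_left.2 hy⟩, by simp [hf]⟩
  have hmap := hiso.map_euclideanHausdorffMeasure (d := d - 1)
  rw [hrange, ← hfin, InnerProductSpace.euclideanHausdorffMeasure_eq_volume, hfin] at hmap
  rw [← hmap]
  refine ⟨fun K hK => ?_⟩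
  rw [Measure.map_apply hiso.continuous.measurable hK.measurableSet]
  exact (hiso.isClosedEmbedding.isCompact_preimage hK).measure_lt_top

/-- Makes the surface estimate extend to Borel sets. Restricting to the hyperplane matters: on all
of `ℝ^d` the `(d-1)`-dimensional measure is not locally finite. -/
theorem outerRegular_hausdorff_hyperplane (hd : 1 ≤ d) (x : E d) {ν : E d} (hν : ‖ν‖ = 1) :
    ((μHE[d - 1] : Measure (E d)).restrict (hyperplane x ν)).OuterRegular := by
  have := isFiniteMeasureOnCompacts_hausdorff_hyperplane hd x hν
  have : IsLocallyFiniteMeasure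
    ((μHE[d - 1] : Measure (E d)).restrict (hyperplane x ν)) := inferInstance
  infer_instance

theorem affineFn_neg (A : Matrix (Fin d) (Fin d) ℝ) (b : E d) :
    affineFn (-A) (-b) = -affineFn A b := by
  refine Subtype.ext (funext fun x => ?_)
  change Matrix.toEuclideanLin (-A) x + -b = -(Matrix.toEuclideanLin A x + b)
  rw [map_neg, LinearMap.neg_apply, neg_add]

namespace IsGammaLimit

variable {p : Params} {Fn : ℕ → Functional d} {F : Functional d}

/-- One inequality suffices; equality follows by applying it to the opposite motion. -/
theorem rigid_le (h : IsGammaLimit p Fn F) (u : L1loc d) {A : Matrix (Fin d) (Fin d) ℝ} (b : E d)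
    (B : Set (E d)) (hA : A.transpose = -A) :
    borelExt F (u + affineFn A b) B ≤ borelExt F u B := by
  have := borelExt_le_add_measure (F := F) (u := u) (v := u + affineFn A b) (0 : Measure (E d))
    (fun U hU => h.translate_le u _ hU fun n v => by
      simp [(h.mem n).rigid v A b U hA hU.1.measurableSet]) B
  simpa using this

/-- The canonical extension of the Γ-limit is in the class `𝔉`. -/
theorem memF (hd : 1 ≤ d) (h : IsGammaLimit p Fn F) : MemF p (borelExt F) where
  measure := h.exists_measure
  outer u B _ := borelExt_eq_iInf F u B
  locality U hU u v huv := by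
    rw [h.borelExt_eq u hU, h.borelExt_eq v hU]
    exact h.locality hU huv
  lower U hU u _ := by
    rw [h.borelExt_eq u hU]
    exact h.lower u hU
  upper U hU u _ := by
    rw [h.borelExt_eq u hU]
    exact h.upper u hU
  infinite U hU u hu := by
    rw [h.borelExt_eq u hU]
    exact h.infinite hU hu
  rigid u A b B hA _ := by
    refine le_antisymm (h.rigid_le u b B hA) ?_
    have := h.rigid_le (u + affineFn A b) (A := -A) (-b) B (by rw [Matrix.transpose_neg, hA])
    rwa [affineFn_neg, add_neg_cancel_right] at this
  bulk u A B hA _ := by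
    have hc : (p.c₅ : ℝ≥0∞) * ENNReal.ofReal (frob A) ≠ ⊤ :=
      ENNReal.mul_ne_top ENNReal.coe_ne_top ENNReal.ofReal_ne_top
    have := Measure.OuterRegular.smul (volume : Measure (E d)) hc
    exact borelExt_le_add_measure ((p.c₅ * ENNReal.ofReal (frob A)) • volume) (fun U hU =>
      h.translate_le u _ hU fun n v => (h.mem n).bulk v A U hA hU.1.measurableSet) B
  surface u x ζ ν B hν hB := by
    have := outerRegular_hausdorff_hyperplane hd x hν
    have := Measure.OuterRegular.smul
      ((μHE[d - 1] : Measure (E d)).restrict (hyperplane x ν)) (ENNReal.coe_ne_top (r := p.σ ‖ζ‖₊))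
    have := borelExt_le_add_measure (F := F) (u := u) (v := u + jumpFn x ζ ν)
      ((p.σ ‖ζ‖₊ : ℝ≥0∞) • (μHE[d - 1] : Measure (E d)).restrict (hyperplane x ν)) (fun U hU =>
      h.translate_le u _ hU fun n v => by
        rw [Measure.smul_apply, Measure.restrict_apply hU.1.measurableSet]
        exact (h.mem n).surface v x ζ ν U hν hU.1.measurableSet) B
    rwa [Measure.smul_apply, Measure.restrict_apply hB] at this

/-- On open sets, possibly unbounded, the extension is a supremum of Γ-limits, each lower
semicontinuous. -/
theorem lowerSemicontinuous_borelExt (h : IsGammaLimit p Fn F) {U : Set (E d)} (hU : IsOpen U) :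
    LowerSemicontinuous fun u : L1loc d => borelExt F u U := by
  simp only [borelExt_of_isOpen F _ hU]
  exact lowerSemicontinuous_iSup fun V => lowerSemicontinuous_iSup fun hV =>
    lowerSemicontinuous_iSup fun _ => (h.conv V hV).lowerSemicontinuous

end IsGammaLimit

/-- A functional in `𝔉` is the canonical extension of its values on bounded open sets. -/
theorem MemF.eq_borelExt {p : Params} {F : Functional d} (h : MemF p F) (u : L1loc d)
    {B : Set (E d)} (hB : MeasurableSet B) : F u B = borelExt F u B := by
  have hopen : ∀ U, IsOpen U → F u U = ⨆ (V : Set (E d)) (_ : IsBddOpen V) (_ : V ⊆ U), F u V := by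
    intro U hU
    refine le_antisymm ?_ (iSup_le fun V => iSup₂_le fun hV hVU =>
      h.mono u hV.1.measurableSet hU.measurableSet hVU)
    obtain ⟨μ, hμ⟩ := h.measure u
    set W : ℕ → Set (E d) := fun n => U ∩ Metric.ball 0 n with hW
    have hWb : ∀ n, IsBddOpen (W n) := fun n =>
      ⟨hU.inter Metric.isOpen_ball, Metric.isBounded_ball.subset Set.inter_subset_right⟩
    have hWU : ⋃ n, W n = U := by
      rw [hW, ← Set.inter_iUnion, Metric.iUnion_ball_nat, Set.inter_univ]
    have hWm : Monotone W := fun m n hmn => Set.inter_subset_inter_right _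
      (Metric.ball_subset_ball (by exact_mod_cast hmn))
    rw [hμ U hU.measurableSet, ← hWU, hWm.measure_iUnion]
    refine iSup_le fun n => ?_
    rw [← hμ _ (hWb n).1.measurableSet]
    exact le_iSup_of_le (W n) (le_iSup₂_of_le (hWb n) (Set.subset_iUnion W n) le_rfl)
  rw [h.outer u B hB]
  exact iInf_congr fun U => iInf_congr fun hU => iInf_congr fun _ => hopen U hU

/-! ### The recession rate -/

/-- The left side need not be monotone in `y`, but its sublevel at `R ≥ 0` is closed under
decreasing `y`. With `r = x / y ≤ 1` one has `r y^(1-α) ≤ x^(1-α)`, so `k x - A x^(1-α) ≤ r (k y - A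
y^(1-α)) ≤ r (R + B) ≤ R + B`, whatever the sign of `k`. -/
theorem sub_rpow_sub_le_of_le {k A B R α x y : ℝ} (hA : 0 ≤ A) (hB : 0 ≤ B) (hR : 0 ≤ R)
    (hα0 : 0 < α) (hα1 : α < 1) (hx : 0 ≤ x) (hxy : x ≤ y)
    (h : k * y - A * y ^ (1 - α) - B ≤ R) : k * x - A * x ^ (1 - α) - B ≤ R := by
  rcases hx.eq_or_lt with rfl | hx0
  · rw [Real.zero_rpow (by linarith)]
    linarith
  have hy0 : 0 < y := hx0.trans_le hxy
  set r := x / y with hr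
  have hr0 : 0 < r := div_pos hx0 hy0
  have hr1 : r ≤ 1 := (div_le_one hy0).2 hxy
  have hxr : x = r * y := (div_mul_cancel₀ x hy0.ne').symm
  have hpow : r * y ^ (1 - α) ≤ x ^ (1 - α) := by
    rw [hxr, Real.mul_rpow hr0.le hy0.le]
    refine mul_le_mul_of_nonneg_right ?_ (Real.rpow_nonneg hy0.le _)
    exact Real.self_le_rpow_of_le_one hr0.le hr1 (by linarith)
  have h1 : A * (r * y ^ (1 - α)) ≤ A * x ^ (1 - α) := mul_le_mul_of_nonneg_left hpow hA
  have h2 : r * (k * y - A * y ^ (1 - α)) ≤ r * (R + B) :=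
    mul_le_mul_of_nonneg_left (by linarith) hr0.le
  have h3 : r * (R + B) ≤ R + B := mul_le_of_le_one_left (by linarith) hr1
  have h4 : k * x = r * (k * y) := by rw [hxr]; ring
  linarith [mul_left_comm r A (y ^ (1 - α)), mul_sub r (k * y) (A * y ^ (1 - α))]

theorem MemF.lt_top {p : Params} {G : Functional d} (h : MemF p G) {u : L1loc d} {U : Set (E d)}
    (hU : IsBddOpen U) (hu : IsBD u U) : G u U < ⊤ :=
  (h.le_upper u hU).trans_lt (ENNReal.add_lt_top.2
    ⟨ENNReal.mul_lt_top ENNReal.coe_lt_top hu.2,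
      ENNReal.mul_lt_top ENNReal.coe_lt_top hU.volume_lt_top⟩)

theorem MemF.isBD_of_lt_top {p : Params} {G : Functional d} (h : MemF p G) {u : L1loc d}
    {U : Set (E d)} (hU : IsBddOpen U) (hG : G u U < ⊤) : IsBD u U := by
  by_contra hcon
  exact hG.ne (h.infinite U hU u hcon)

theorem IsGammaLimit.lt_top {p : Params} {Fn : ℕ → Functional d} {F : Functional d}
    (h : IsGammaLimit p Fn F) {u : L1loc d} {U : Set (E d)}
    (hU : IsBddOpen U) (hu : IsBD u U) : F u U < ⊤ :=
  (h.upper u hU).trans_lt (ENNReal.add_lt_top.2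
    ⟨ENNReal.mul_lt_top ENNReal.coe_lt_top hu.2,
      ENNReal.mul_lt_top ENNReal.coe_lt_top hU.volume_lt_top⟩)

/-- One side of (g) is enough, as its right side is symmetric in `s` and `t`. The terms in `F (s •
u)`, collected in `R`, converge along a recovery sequence. Those in `F (t • u)` are controlled only
from below, and their coefficient `k` may be negative. -/
theorem IsGammaLimit.rate_le {p : Params} {Fn : ℕ → Functional d} {F : Functional d}
    (h : IsGammaLimit p Fn F) (hrate : ∀ n, RecessionRate p (Fn n)) {U : Set (E d)}
    (hU : IsBddOpen U) {u : L1loc d} (hu : IsBD u U) {s t : ℝ} (hs : 0 < s) (ht : 0 < t) :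
    (F (t • u) U).toReal / t - (F (s • u) U).toReal / s ≤
      p.c₆ / s * volume.real U ^ p.α * (F (s • u) U).toReal ^ (1 - p.α)
      + p.c₆ / s * volume.real U
      + p.c₆ / t * volume.real U ^ p.α * (F (t • u) U).toReal ^ (1 - p.α)
      + p.c₆ / t * volume.real U
      + p.c₇ * ((F (s • u) U).toReal / s + (F (t • u) U).toReal / t) * (1 / s + 1 / t) := by
  have hα1 : 0 < 1 - p.α := by linarith [p.α_lt_one]
  set m := volume.real U with hm
  have hm0 : 0 ≤ m := measureReal_nonneg
  have hmα : 0 ≤ m ^ p.α := Real.rpow_nonneg hm0 _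
  set A := p.c₆ / t * m ^ p.α with hA
  set B := p.c₆ / t * m with hB
  set k := 1 / t - p.c₇ * (1 / t) * (1 / s + 1 / t) with hk
  set R : ℝ → ℝ := fun a => a / s + p.c₆ / s * m ^ p.α * a ^ (1 - p.α) + p.c₆ / s * m +
    p.c₇ * (a / s) * (1 / s + 1 / t) with hR
  have hA0 : 0 ≤ A := by positivity
  have hB0 : 0 ≤ B := by positivity
  have hR0 : ∀ a, 0 ≤ a → 0 ≤ R a := fun a ha => by
    have := Real.rpow_nonneg ha (1 - p.α)
    positivity
  have hRc : Continuous R := by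
    have := Real.continuous_rpow_const hα1.le
    simp only [hR]
    fun_prop
  have hsu : F (s • u) U < ⊤ := h.lt_top hU (hu.smul hs.le)
  have htu : F (t • u) U < ⊤ := h.lt_top hU (hu.smul ht.le)
  suffices hmain : k * (F (t • u) U).toReal - A * (F (t • u) U).toReal ^ (1 - p.α) - B ≤
      R (F (s • u) U).toReal by
    have : k * (F (t • u) U).toReal = (F (t • u) U).toReal / t -
        p.c₇ * ((F (t • u) U).toReal / t) * (1 / s + 1 / t) := by rw [hk]; ring
    rw [this] at hmain
    simp only [hR] at hmain
    rw [mul_add (p.c₇ : ℝ), add_mul]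
    linarith
  obtain ⟨v, hv, hvF⟩ := (h.conv U hU).recovery (s • u)
  set w : ℕ → L1loc d := fun n => s⁻¹ • v n with hw
  have hwv : ∀ n, s • w n = v n := fun n => smul_inv_smul₀ hs.ne' (v n)
  have hwt : Tendsto (fun n => t • w n) atTop (𝓝 (t • u)) := by
    have h1 := L1loc.tendsto_const_smul (L1loc.tendsto_const_smul hv s⁻¹) t
    rwa [inv_smul_smul₀ hs.ne'] at h1
  have hRlim : Tendsto (fun n => R (Fn n (v n) U).toReal) atTop (𝓝 (R (F (s • u) U).toReal)) :=
    (hRc.tendsto _).comp ((ENNReal.tendsto_toReal hsu.ne).comp hvF)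
  have hBD : ∀ᶠ n in atTop, IsBD (w n) U := by
    filter_upwards [hvF.eventually_lt_const hsu] with n hn
    exact ((h.mem n).isBD_of_lt_top hU hn).smul (inv_pos.2 hs).le
  -- Any `x` below `F (t • u) U` is eventually below the energies of `t • w n`; (g) for `Fn n`
  -- bounds the expression at the latter, and `sub_rpow_sub_le_of_le` carries the bound down to `x`.
  have hx : ∀ x, 0 ≤ x → x < (F (t • u) U).toReal →
      k * x - A * x ^ (1 - p.α) - B ≤ R (F (s • u) U).toReal := by
    intro x hx0 hx
    have hlt : ENNReal.ofReal x < liminf (fun n => Fn n (t • w n) U) atTop :=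
      ((ENNReal.ofReal_lt_iff_lt_toReal hx0 htu.ne).2 hx).trans_le
        ((h.conv U hU).liminf_le _ _ hwt)
    refine ge_of_tendsto hRlim ?_
    filter_upwards [hBD, eventually_lt_of_lt_liminf hlt] with n hn hxn
    have hfin : Fn n (t • w n) U < ⊤ := (h.mem n).lt_top hU (hn.smul ht.le)
    have hxy : x ≤ (Fn n (t • w n) U).toReal :=
      ((ENNReal.ofReal_lt_iff_lt_toReal hx0 hfin.ne).1 hxn).le
    refine sub_rpow_sub_le_of_le hA0 hB0 (hR0 _ ENNReal.toReal_nonneg) p.α_pos p.α_lt_one hx0 hxy ?_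
    have hr := hrate n U hU (w n) hn s t hs ht
    rw [hwv n] at hr
    have hr' := (neg_le_abs _).trans hr
    have : k * (Fn n (t • w n) U).toReal = (Fn n (t • w n) U).toReal / t -
        p.c₇ * ((Fn n (t • w n) U).toReal / t) * (1 / s + 1 / t) := by rw [hk]; ring
    rw [this]
    simp only [hR]
    rw [mul_add (p.c₇ : ℝ), add_mul] at hr'
    linarith
  -- It remains to let `x` increase to `F (t • u) U`. If that value is `0` no such `x` exists, but
  -- then the left side is `-B ≤ 0`.
  rcases (ENNReal.toReal_nonneg (a := F (t • u) U)).eq_or_lt with h0 | h0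
  · rw [← h0, Real.zero_rpow hα1.ne']
    linarith [hR0 _ (ENNReal.toReal_nonneg (a := F (s • u) U))]
  · have hc : Continuous fun x : ℝ => k * x - A * x ^ (1 - p.α) - B := by
      have := Real.continuous_rpow_const hα1.le
      fun_prop
    refine le_of_tendsto ((hc.tendsto _).mono_left
      (nhdsWithin_le_nhds (s := Set.Iio (F (t • u) U).toReal))) ?_
    filter_upwards [Ioo_mem_nhdsLT h0] with x hx'
    exact hx x hx'.1.le hx'.2

/-- The quantitative recession-rate inequality passes to the Γ-limit. -/
theorem IsGammaLimit.recessionRate {p : Params} {Fn : ℕ → Functional d} {F : Functional d}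
    (h : IsGammaLimit p Fn F) (hrate : ∀ n, RecessionRate p (Fn n)) :
    RecessionRate p (borelExt F) := by
  intro U hU u hu s t hs ht
  rw [h.borelExt_eq _ hU, h.borelExt_eq _ hU]
  refine abs_le'.2 ⟨?_, ?_⟩
  · have := h.rate_le hrate hU hu ht hs
    rw [add_comm ((F (t • u) U).toReal / t), add_comm (1 / t)] at this
    linarith
  · have := h.rate_le hrate hU hu hs ht
    linarith

/-! ### Invariance of the classes under equality on Borel sets, and conclusion. -/

theorem MemF.congr {p : Params} {F G : Functional d} (h : MemF p G)
    (hFG : ∀ u B, MeasurableSet B → F u B = G u B) : MemF p F where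
  measure u := by
    obtain ⟨μ, hμ⟩ := h.measure u
    exact ⟨μ, fun B hB => (hFG u B hB).trans (hμ B hB)⟩
  outer u B hB := by
    rw [hFG u B hB, h.outer u B hB]
    exact iInf_congr fun U => iInf_congr fun hU => iInf_congr fun _ =>
      (hFG u U hU.measurableSet).symm
  locality U hU u v huv := by
    rw [hFG u U hU.1.measurableSet, hFG v U hU.1.measurableSet]
    exact h.locality U hU u v huv
  lower U hU u hu := by
    rw [hFG u U hU.1.measurableSet]
    exact h.lower U hU u hu
  upper U hU u hu := by
    rw [hFG u U hU.1.measurableSet]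
    exact h.upper U hU u hu
  infinite U hU u hu := by
    rw [hFG u U hU.1.measurableSet]
    exact h.infinite U hU u hu
  rigid u A b B hA hB := by
    rw [hFG _ B hB, hFG _ B hB]
    exact h.rigid u A b B hA hB
  bulk u A B hA hB := by
    rw [hFG _ B hB, hFG _ B hB]
    exact h.bulk u A B hA hB
  surface u x ζ ν B hν hB := by
    rw [hFG _ B hB, hFG _ B hB]
    exact h.surface u x ζ ν B hν hB

theorem MemFAlphaSc.congr {p : Params} {F G : Functional d} (h : MemFAlphaSc p G)
    (hFG : ∀ u B, MeasurableSet B → F u B = G u B) : MemFAlphaSc p F where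
  memFAlpha :=
    { memF := h.memFAlpha.memF.congr hFG
      rate := fun U hU u hu s t hs ht => by
        rw [hFG _ U hU.1.measurableSet, hFG _ U hU.1.measurableSet]
        exact h.memFAlpha.rate U hU u hu s t hs ht }
  lsc U hU := by
    simp only [hFG _ U hU.measurableSet]
    exact h.lsc U hU

end BDGamma

end

theorem mainTheorem7 {d : ℕ} (hd : 1 ≤ d) (p : BDGamma.Params)
    (Fn : ℕ → BDGamma.Functional d) (F : BDGamma.Functional d)
    (hFn : ∀ n, BDGamma.MemFAlpha p (Fn n))
    (hΓ : ∀ U : Set (BDGamma.E d), BDGamma.IsBddOpen U →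
      BDGamma.GammaConverges (fun n u => Fn n u U) (fun u => F u U)) :
    (∀ (u : BDGamma.L1loc d) (U : Set (BDGamma.E d)), BDGamma.IsBddOpen U →
      BDGamma.borelExt F u U = F u U) ∧
    BDGamma.MemFAlphaSc p (BDGamma.borelExt F) ∧
    (BDGamma.MemFAlphaSc p F ↔
      ∀ (u : BDGamma.L1loc d) (B : Set (BDGamma.E d)), MeasurableSet B →
        F u B = BDGamma.borelExt F u B) := by
  have h : BDGamma.IsGammaLimit p Fn F := ⟨fun n => (hFn n).memF, hΓ⟩
  have hsc : BDGamma.MemFAlphaSc p (BDGamma.borelExt F) :=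
    ⟨⟨h.memF hd, h.recessionRate fun n => (hFn n).rate⟩,
      fun U hU => h.lowerSemicontinuous_borelExt hU⟩
  -- The forward implication uses only membership in `𝔉`: a Borel measure that is outer regular by
  -- open sets is fixed by its values on bounded open sets. The converse holds because every
  -- condition tests Borel sets only.
  exact ⟨fun u U hU => h.borelExt_eq u hU, hsc,
    fun hF u B hB => hF.memFAlpha.memF.eq_borelExt u hB, fun hF => hsc.congr hF⟩
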